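/- **Theorem (Oracle inequality).** Let $t\ge 1$, let $\mathcal Q_1,\dots,\mathcal Q_t$ be probability distributions on an interval $[a,b]$ with means $\mu_j$ and variances $\sigma_j^2$, let $B_1,\dots,B_t\ge 1$ be integers, and let $u_{j,i}$ ($1\le j\le t$, $1\le i\le B_j$) be mutually independent random variables with $u_{j,i}\sim\mathcal Q_j$. Put $M=b-a$ and, for $k\in[t]=\{1,\dots,t\}$, $B_{t,k}=\sum_{j=t-k+1}^t B_j$, $\sigma_{t,k}^2=B_{t,k}^{-1}\sum_{j=t-k+1}^t B_j\sigma_j^2$, $$\phi(t,k)=\max_{t-k+1\le j\le t}|\mu_j-\mu_t|,$$ $$\psi(t,k,\delta)=\begin{cases} M, & B_{t,k}=1,\\ \sigma_{t,k}\sqrt{\dfrac{2\log(2/\delta)}{B_{t,k}}}+\dfrac{2M\log(2/\delta)}{3B_{t,k}}, & B_{t,k}\ge 2.\end{cases}$$ Let $$\widehat\mu_{t,k}=\frac1{B_{t,k}}\sum_{j=t-k+1}^t\sum_{i=1}^{B_j}u_{j,i},\qquad \widehat v_{t,k}^2=\frac1{B_{t,k}-1}\sum_{j=t-k+1}^t\sum_{i=1}^{B_j}(u_{j,i}-\widehat\mu_{t,k})^2,$$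 $$\widehat\psi(t,k,\delta)=\begin{cases} M, & B_{t,k}=1,\\ \widehat v_{t,k}\sqrt{\dfrac{2\log(2/\delta)}{B_{t,k}}}+\dfrac{8M\log(2/\delta)}{3(B_{t,k}-1)}, & B_{t,k}\ge2,\end{cases}$$ $$\widehat\phi(t,k,\delta)=\max_{i\in[k]}\Big(|\widehat\mu_{t,k}-\widehat\mu_{t,i}|-\big[\widehat\psi(t,k,\delta)+\widehat\psi(t,i,\delta)\big]\Big)_+ .$$ Let $\delta\in(0,1)$ and $\delta'=\delta/(3t)$. The adaptive rolling-window algorithm selects any $\widehat k\in\operatorname{argmin}_{k\in[t]}\{\widehat\phi(t,k,\delta')+\widehat\psi(t,k,\delta')\}$ and outputs $\widehat\mu_{t,\widehat k}$. There is a universal constant $C>0$ (independent of $t$, $\delta$, $a$, $b$, the $B_j$ and the $\mathcal Q_j$) such that, with probability at least $1-\delta$, every such choice of $\widehat k$ satisfies $$|\widehat\mu_{t,\widehat k}-\mu_t|\le C\log(6t/\delta)\,\min_{k\in[t]}\{\phi(t,k)+\psi(t,k,\delta)\}.$$ More precisely, with probability at least $1-\delta$, every such choice of $\widehat k$ satisfies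 $$|\widehat\mu_{t,\widehat k}-\mu_t|\le 3\min_{k\in[t]}\left\{3\sqrt{\log(6t/\delta)}\,\phi(t,k)+\sigma_{t,k}\sqrt{\frac{2\log(6t/\delta)}{B_{t,k}}}+\frac{10(b-a)\log(6t/\delta)}{B_{t,k}}\right\}.$$ -/

import Mathlib

open MeasureTheory ProbabilityTheory

noncomputable section

namespace RollingWindow

/-- The periods `t - k + 1, …, t` in the look-back window of length `k` (for `1 ≤ k ≤ t`). -/
def window (t k : ℕ) : Finset ℕ := Finset.Icc (t - k + 1) t

/-- The pairs `⟨j, i⟩` with `1 ≤ j ≤ t` and `1 ≤ i ≤ B j` that index all samples up to time `t`. -/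
def sampleIndex (B : ℕ → ℕ) (t : ℕ) : Finset (Σ _ : ℕ, ℕ) :=
  (Finset.Icc 1 t).sigma fun j => Finset.Icc 1 (B j)

/-- `B_{t,k}`, the number of samples in the window. -/
def windowSize (B : ℕ → ℕ) (t k : ℕ) : ℕ := ∑ j ∈ window t k, B j

/-! ### Population quantities -/

/-- The mean `μ_j` of `Q_j`. -/
def popMean (Q : ℕ → Measure ℝ) (j : ℕ) : ℝ := ∫ x, x ∂(Q j)

/-- The averaged standard deviation `σ_{t,k}`, the square root of
`σ_{t,k}² = B_{t,k}⁻¹ ∑_{j=t-k+1}^t B_j σ_j²`, where `σ_j²` is the variance of `Q_j`. -/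
def popStd (Q : ℕ → Measure ℝ) (B : ℕ → ℕ) (t k : ℕ) : ℝ :=
  √((windowSize B t k : ℝ)⁻¹ * ∑ j ∈ window t k, (B j : ℝ) * variance (fun x : ℝ => x) (Q j))

/-- The drift `φ(t,k) = max_{t-k+1 ≤ j ≤ t} |μ_j - μ_t|`. -/
def phi (Q : ℕ → Measure ℝ) (t k : ℕ) : ℝ :=
  ⨆ j : window t k, |popMean Q j - popMean Q t|

/-- The Bernstein deviation term `ψ(t,k,δ)` for samples in an interval of length `M`. -/
def psi (Q : ℕ → Measure ℝ) (B : ℕ → ℕ) (M : ℝ) (t k : ℕ) (δ : ℝ) : ℝ :=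
  if windowSize B t k = 1 then M
  else popStd Q B t k * √(2 * Real.log (2 / δ) / windowSize B t k)
    + 2 * M * Real.log (2 / δ) / (3 * windowSize B t k)

/-! ### Quantities computed from the data `x j i`, `1 ≤ i ≤ B j` -/

/-- The window average `μ̂_{t,k}`. -/
def empMean (B : ℕ → ℕ) (x : ℕ → ℕ → ℝ) (t k : ℕ) : ℝ :=
  (windowSize B t k : ℝ)⁻¹ * ∑ j ∈ window t k, ∑ i ∈ Finset.Icc 1 (B j), x j i

/-- The sample standard deviation `v̂_{t,k}` over the window (used only if `B_{t,k} ≥ 2`). -/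
def empStd (B : ℕ → ℕ) (x : ℕ → ℕ → ℝ) (t k : ℕ) : ℝ :=
  √(((windowSize B t k : ℝ) - 1)⁻¹ *
    ∑ j ∈ window t k, ∑ i ∈ Finset.Icc 1 (B j), (x j i - empMean B x t k) ^ 2)

/-- The proxy `ψ̂(t,k,δ)`. -/
def psiHat (B : ℕ → ℕ) (x : ℕ → ℕ → ℝ) (M : ℝ) (t k : ℕ) (δ : ℝ) : ℝ :=
  if windowSize B t k = 1 then M
  else empStd B x t k * √(2 * Real.log (2 / δ) / windowSize B t k)
    + 8 * M * Real.log (2 / δ) / (3 * ((windowSize B t k : ℝ) - 1))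

/-- The proxy `φ̂(t,k,δ) = max_{i ∈ [k]} (|μ̂_{t,k} - μ̂_{t,i}| - [ψ̂(t,k,δ) + ψ̂(t,i,δ)])₊`. -/
def phiHat (B : ℕ → ℕ) (x : ℕ → ℕ → ℝ) (M : ℝ) (t k : ℕ) (δ : ℝ) : ℝ :=
  ⨆ i : Finset.Icc 1 k,
    max (|empMean B x t k - empMean B x t i| - (psiHat B x M t k δ + psiHat B x M t i δ)) 0

/-- The windows that the adaptive rolling-window algorithm with data `x` and hyperparameters
`δ'`, `M` may select: the minimizers of `φ̂(t,k,δ') + ψ̂(t,k,δ')` over `k ∈ [t]`.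
Its output is `empMean B x t k` for any one such `k`. -/
def selectedWindows (B : ℕ → ℕ) (x : ℕ → ℕ → ℝ) (M : ℝ) (t : ℕ) (δ' : ℝ) : Set ℕ :=
  {k | k ∈ Finset.Icc 1 t ∧ ∀ k' ∈ Finset.Icc 1 t,
    phiHat B x M t k δ' + psiHat B x M t k δ' ≤ phiHat B x M t k' δ' + psiHat B x M t k' δ'}

/-- The algorithm always has a window to select. -/
theorem selectedWindows_nonempty (B : ℕ → ℕ) (x : ℕ → ℕ → ℝ) (M : ℝ) {t : ℕ} (ht : 1 ≤ t)
    (δ' : ℝ) : (selectedWindows B x M t δ').Nonempty := by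
  obtain ⟨k, hk, h⟩ := Finset.exists_min_image (Finset.Icc 1 t)
    (fun k => phiHat B x M t k δ' + psiHat B x M t k δ') (Finset.nonempty_Icc.mpr ht)
  exact ⟨k, hk, h⟩

end RollingWindow

end

/-! Everything reduces to one event on which, for each window `k`, the empirical radius ψ̂ does two
things: it covers the error of the window average around its own mean, and it exceeds the Bernstein
radius by at most constant factors plus a drift term of order √L φ, where L = log(2/δ') = log(6t/δ).
Each window fails with probability at most 4 exp(-L), so a union bound over the `t` windows costs
2δ/3. On that event the selection is deterministic (`abs_empMean_selected_sub_le`). Sub-window means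
lie within φ of the current mean, so φ̂ ≤ 2φ. The definition of φ̂ controls the gap between any two
window averages, and minimality trades the selected window for any competitor, giving 5φ + 3ψ̂. The
probabilistic core is `measure_empirical_bernstein_le`. Bernstein controls the mean through the true
variance, which must then be replaced by the sample variance. The latter is a U-statistic with
kernel (x-y)²/2. Following Hoeffding, it is an average over permutations of sums over disjoint,
hence independent, pairs, so Jensen's inequality transfers an exponential moment bound for one pair
to the whole statistic. Samples need not be identically distributed: differing means only add a
nonnegative bias to the expected sample variance, harmless for coverage and responsible for the term
√L φ in the upper bound on ψ̂. -/

namespace RollingWindow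

/-! ### The Bernstein inequality for independent bounded random variables -/

/-- For x ≥ 0 this is the Padé bound exp x ≤ (2+x)/(2-x) = 1 + x + x²/(2-x). For x ≤ 0 even the
denominator 2 works, because (1+x+x²/2)(1-x+x²/2) = 1 + x⁴/4 ≥ 1 while exp(-x) ≥ 1 - x + x²/2. -/
theorem exp_le_one_add_add_sq_div {x c : ℝ} (hx : |x| ≤ c) (hc : c < 2) :
    Real.exp x ≤ 1 + x + x ^ 2 / (2 - c) := by
  have hmono : x ^ 2 / (2 - |x|) ≤ x ^ 2 / (2 - c) := by
    gcongr
  refine le_trans ?_ (add_le_add_right hmono (1 + x))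
  rcases le_total 0 x with h | h
  · rw [abs_of_nonneg h] at hx ⊢
    have h2 : 0 < 2 - x := by linarith
    refine (Real.exp_le_two_add_div_two_sub h (by linarith)).trans (le_of_eq ?_)
    field_simp
    ring
  · rw [abs_of_nonpos h] at hx ⊢
    have h2 : 0 < 2 - -x := by linarith
    have hq := Real.quadratic_le_exp_of_nonneg (x := -x) (by linarith)
    have hle : Real.exp x ≤ 1 + x + x ^ 2 / 2 := by
      have hpos := Real.exp_pos x
      have hmul : Real.exp x * Real.exp (-x) = 1 := by rw [← Real.exp_add]; simp
      have hs : 0 ≤ 1 + x + x ^ 2 / 2 := by nlinarith [sq_nonneg (x + 1)]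
      have h1 : Real.exp x * (1 + -x + (-x) ^ 2 / 2) ≤ 1 := by
        refine le_trans ?_ hmul.le
        gcongr
      have hD : 0 < 1 + -x + (-x) ^ 2 / 2 := by nlinarith [sq_nonneg x]
      refine le_of_mul_le_mul_right (h1.trans ?_) hD
      nlinarith [sq_nonneg (x ^ 2)]
    refine hle.trans ?_
    gcongr
    linarith

section

variable {Ω : Type*} [MeasurableSpace Ω] {P : Measure Ω} [IsProbabilityMeasure P]

theorem memLp_of_ae_mem_Icc {Y : Ω → ℝ} {a b : ℝ} (hY : AEMeasurable Y P)
    (hab : ∀ᵐ ω ∂P, Y ω ∈ Set.Icc a b) : MemLp Y 2 P :=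
  memLp_of_bounded hab hY.aestronglyMeasurable 2

theorem integral_mem_Icc {Y : Ω → ℝ} {a b : ℝ} (hY : AEMeasurable Y P)
    (hab : ∀ᵐ ω ∂P, Y ω ∈ Set.Icc a b) : ∫ ω, Y ω ∂P ∈ Set.Icc a b := by
  have hi : Integrable Y P := Integrable.of_mem_Icc a b hY hab
  constructor
  · have := integral_mono_ae (integrable_const a) hi (hab.mono fun ω h => h.1)
    simpa using this
  · have := integral_mono_ae hi (integrable_const b) (hab.mono fun ω h => h.2)
    simpa using this

theorem integrable_exp_of_ae_mem_Icc {Y : Ω → ℝ} {a b : ℝ} (hY : AEMeasurable Y P)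
    (hab : ∀ᵐ ω ∂P, Y ω ∈ Set.Icc a b) : Integrable (fun ω => Real.exp (Y ω)) P :=
  Integrable.of_mem_Icc (Real.exp a) (Real.exp b) (Real.measurable_exp.comp_aemeasurable hY)
    (hab.mono fun _ h => ⟨Real.exp_le_exp.mpr h.1, Real.exp_le_exp.mpr h.2⟩)

/-- Integrating the quadratic majorant of exp kills the linear term and leaves 1 + y, which is at
most exp y. -/
theorem mgf_sub_integral_le {Y : Ω → ℝ} {a b l : ℝ} (hY : AEMeasurable Y P)
    (hab : ∀ᵐ ω ∂P, Y ω ∈ Set.Icc a b) (hl : 0 ≤ l) (hl2 : l * (b - a) < 2) :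
    mgf (fun ω => Y ω - ∫ ω', Y ω' ∂P) P l ≤ Real.exp (l ^ 2 * Var[Y; P] / (2 - l * (b - a))) := by
  set m := ∫ ω', Y ω' ∂P with hm
  have hmem := integral_mem_Icc hY hab
  have hi : Integrable Y P := Integrable.of_mem_Icc a b hY hab
  have hL2 : MemLp (fun ω => Y ω - m) 2 P := (memLp_of_ae_mem_Icc hY hab).sub (memLp_const m)
  have hbd : ∀ᵐ ω ∂P, |l * (Y ω - m)| ≤ l * (b - a) := by
    filter_upwards [hab] with ω h
    rw [abs_mul, abs_of_nonneg hl]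
    gcongr
    rw [abs_le]
    constructor <;> linarith [h.1, h.2, hmem.1, hmem.2]
  have hint1 : Integrable (fun ω => l * (Y ω - m)) P := (hi.sub (integrable_const m)).const_mul l
  have hint2 : Integrable (fun ω => (l * (Y ω - m)) ^ 2 / (2 - l * (b - a))) P := by
    simp_rw [mul_pow]
    exact (hL2.integrable_sq.const_mul _).div_const _
  have hint3 : Integrable (fun ω => 1 + l * (Y ω - m)) P := (integrable_const _).add hint1
  have hint0 : Integrable (fun ω => Real.exp (l * (Y ω - m))) P :=
    integrable_exp_of_ae_mem_Icc ((hY.sub_const m).const_mul l)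
      (hbd.mono fun ω h => abs_le.mp h)
  calc mgf (fun ω => Y ω - m) P l
      ≤ ∫ ω, (1 + l * (Y ω - m) + (l * (Y ω - m)) ^ 2 / (2 - l * (b - a))) ∂P :=
        integral_mono_ae hint0 (hint3.add hint2) (hbd.mono fun ω h => exp_le_one_add_add_sq_div h hl2)
    _ = 1 + l ^ 2 * Var[Y; P] / (2 - l * (b - a)) := by
        rw [integral_add hint3 hint2, integral_add (integrable_const _) hint1,
          integral_const_mul, integral_sub hi (integrable_const m), integral_div]
        simp_rw [mul_pow]
        rw [integral_const_mul, variance_eq_integral hY]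
        simp [hm]
    _ ≤ _ := by
        rw [add_comm]; exact Real.add_one_le_exp _

variable {ι : Type*} [Fintype ι] {X : ι → Ω → ℝ} {a b : ℝ}

theorem measure_sum_sub_integral_ge_le (hX : ∀ i, AEMeasurable (X i) P)
    (hab : ∀ i, ∀ᵐ ω ∂P, X i ω ∈ Set.Icc a b) (hind : iIndepFun X P) (hlt : a < b)
    {L : ℝ} (hL : 0 < L) :
    P.real {ω | √(2 * (∑ i, Var[X i; P]) * L) + 6 / 5 * (b - a) * L ≤
      ∑ i, (X i ω - ∫ ω', X i ω' ∂P)} ≤ Real.exp (-L) := by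
  set v := ∑ i, Var[X i; P] with hv
  set M := b - a with hM
  have hMpos : 0 < M := sub_pos.mpr hlt
  have hv0 : 0 ≤ v := Finset.sum_nonneg fun i _ => variance_nonneg _ _
  set s := √(2 * v * L) + 6 / 5 * M * L with hs
  have hspos : 0 < s := by positivity
  have hD : 0 < v + 3 / 5 * M * s := by positivity
  -- An almost optimal Chernoff parameter. Any coefficient above 1/2 keeps l * M < 2 even when v =
  -- 0; 3/5 is half of the 6/5 in the deviation term.
  set l := s / (v + 3 / 5 * M * s) with hl
  have hlpos : 0 < l := by positivity
  have hlD : l * (v + 3 / 5 * M * s) = s := div_mul_cancel₀ _ hD.ne'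
  have hlM : l * M < 2 := by
    rw [hl, div_mul_eq_mul_div, div_lt_iff₀ hD]
    nlinarith [mul_pos hMpos hspos]
  have hsub : ∀ i, AEMeasurable (fun ω => X i ω - ∫ ω', X i ω' ∂P) P :=
    fun i => (hX i).sub_const _
  have hind' : iIndepFun (fun i ω => X i ω - ∫ ω', X i ω' ∂P) P :=
    hind.comp (fun i x => x - ∫ ω', X i ω' ∂P) (fun i => by fun_prop)
  have hint : Integrable (fun ω => Real.exp (l * ∑ i, (X i ω - ∫ ω', X i ω' ∂P))) P := by
    refine integrable_exp_of_ae_mem_Icc (a := l * ∑ i : ι, (a - ∫ ω', X i ω' ∂P))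
      (b := l * ∑ i : ι, (b - ∫ ω', X i ω' ∂P)) ?_ ?_
    · exact (Finset.aemeasurable_fun_sum _ fun i _ => hsub i).const_mul l
    · filter_upwards [ae_all_iff.mpr hab] with ω h
      constructor <;> gcongr with i
      · exact (h i).1
      · exact (h i).2
  have hmgf : mgf (fun ω => ∑ i, (X i ω - ∫ ω', X i ω' ∂P)) P l ≤
      Real.exp (l ^ 2 * v / (2 - l * M)) := by
    have h1 := hind'.mgf_sum₀ (t := l) hsub Finset.univ
    have h2 : (∑ i, fun ω => X i ω - ∫ ω', X i ω' ∂P) =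
        fun ω => ∑ i, (X i ω - ∫ ω', X i ω' ∂P) := by
      ext ω; simp
    rw [h2] at h1
    rw [h1, hv, Finset.mul_sum, Finset.sum_div, Real.exp_sum]
    exact Finset.prod_le_prod (fun i _ => mgf_nonneg)
      fun i _ => mgf_sub_integral_le (hX i) (hab i) hlpos.le hlM
  refine (measure_ge_le_exp_mul_mgf s hlpos.le hint).trans ?_
  refine (mul_le_mul_of_nonneg_left hmgf (Real.exp_nonneg _)).trans ?_
  rw [← Real.exp_add, Real.exp_le_exp]
  have h1 : l ^ 2 * v / (2 - l * M) ≤ l * s / 2 := by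
    rw [div_le_div_iff₀ (by linarith) two_pos]
    have : l * v * 2 ≤ s * (2 - l * M) := by
      have h := hlD
      nlinarith [mul_pos (mul_pos hlpos hMpos) hspos]
    nlinarith
  have h2 : L ≤ l * s / 2 := by
    have hsq : √(2 * v * L) * √(2 * v * L) = 2 * v * L := Real.mul_self_sqrt (by positivity)
    have hss : 2 * v * L + 6 / 5 * M * L * s ≤ s * s := by
      have h3 : 0 ≤ √(2 * v * L) * (6 / 5 * M * L) := by positivity
      rw [hs]
      nlinarith
    rw [hl, div_mul_eq_mul_div, div_div, le_div_iff₀ (by positivity)]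
    linarith
  linarith

end

/-! ### Averages over pairs and permutations -/

/-- Double transitivity of the symmetric group: it makes every ordered pair of distinct indices
contribute equally to a sum over permutations. -/
theorem exists_perm_apply_eq_apply_eq {ι : Type*} [DecidableEq ι] {a b c d : ι} (hab : a ≠ b) (hcd : c ≠ d) :
    ∃ τ : Equiv.Perm ι, τ a = c ∧ τ b = d := by
  refine ⟨Equiv.swap (Equiv.swap a c b) d * Equiv.swap a c, ?_, by simp⟩
  have h : c ≠ Equiv.swap a c b := by
    intro h
    apply hab
    apply (Equiv.swap a c).injective
    rw [Equiv.swap_apply_left]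
    exact h
  simp [Equiv.swap_apply_of_ne_of_ne h hcd]

section PairAverage

variable {ι : Type*} [Fintype ι]

/-- The average of `f i j` over ordered pairs of distinct indices, for `f` vanishing on the
diagonal. -/
noncomputable def pairAverage (f : ι → ι → ℝ) : ℝ :=
  ((Fintype.card ι : ℝ) * ((Fintype.card ι : ℝ) - 1))⁻¹ * ∑ i, ∑ j, f i j

theorem sum_perm_apply_eq_pairAverage [DecidableEq ι] (f : ι → ι → ℝ) (hf : ∀ i, f i i = 0)
    {a b : ι} (hab : a ≠ b) :
    ∑ σ : Equiv.Perm ι, f (σ a) (σ b) = (Fintype.card (Equiv.Perm ι) : ℝ) * pairAverage f := by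
  have hn : (2 : ℝ) ≤ Fintype.card ι := by
    have : 1 < Fintype.card ι := Fintype.one_lt_card_iff.mpr ⟨a, b, hab⟩
    exact_mod_cast this
  have hinv : ∀ c d : ι, c ≠ d →
      ∑ σ : Equiv.Perm ι, f (σ c) (σ d) = ∑ σ : Equiv.Perm ι, f (σ a) (σ b) := by
    intro c d hcd
    obtain ⟨τ, rfl, rfl⟩ := exists_perm_apply_eq_apply_eq hab hcd
    exact Fintype.sum_equiv (Equiv.mulRight τ) _ _ fun σ => rfl
  -- The sum over all pairs and all permutations is evaluated twice: here each permutation merely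
  -- reindexes the double sum, and in `hcount` all n(n-1) off-diagonal pairs contribute the same
  -- amount.
  have hdouble : ∑ c, ∑ d, ∑ σ : Equiv.Perm ι, f (σ c) (σ d) =
      (Fintype.card (Equiv.Perm ι) : ℝ) * ∑ i, ∑ j, f i j := by
    have h1 : ∑ c, ∑ d, ∑ σ : Equiv.Perm ι, f (σ c) (σ d) =
        ∑ σ : Equiv.Perm ι, ∑ c, ∑ d, f (σ c) (σ d) := by
      rw [Finset.sum_comm]
      simp_rw [Finset.sum_comm (s := Finset.univ (α := ι)) (t := Finset.univ (α := Equiv.Perm ι))]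
      refine Finset.sum_congr rfl fun σ _ => Finset.sum_comm
    rw [h1]
    have h2 : ∀ σ : Equiv.Perm ι, ∑ c, ∑ d, f (σ c) (σ d) = ∑ i, ∑ j, f i j := fun σ => by
      rw [← Equiv.sum_comp σ (fun i => ∑ j, f i j)]
      exact Finset.sum_congr rfl fun c _ => Equiv.sum_comp σ (fun j => f (σ c) j)
    simp [h2]
  have hcount : ∑ c, ∑ d, ∑ σ : Equiv.Perm ι, f (σ c) (σ d) =
      (Fintype.card ι : ℝ) * ((Fintype.card ι : ℝ) - 1) *
        ∑ σ : Equiv.Perm ι, f (σ a) (σ b) := by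
    have h1 : ∀ c : ι, ∑ d, ∑ σ : Equiv.Perm ι, f (σ c) (σ d) =
        ((Fintype.card ι : ℝ) - 1) * ∑ σ : Equiv.Perm ι, f (σ a) (σ b) := by
      intro c
      rw [← Finset.add_sum_erase _ _ (Finset.mem_univ c),
        Finset.sum_congr rfl fun d hd => hinv c d (Finset.ne_of_mem_erase hd).symm]
      simp only [hf, Finset.sum_const_zero, zero_add, Finset.sum_const, nsmul_eq_mul,
        Finset.card_erase_of_mem (Finset.mem_univ c), Finset.card_univ]
      rw [Nat.cast_sub (Fintype.card_pos_iff.mpr ⟨c⟩)]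
      simp
    simp [h1, mul_assoc]
  rw [pairAverage, mul_left_comm, ← hdouble, hcount, ← mul_assoc, inv_mul_cancel₀ (by nlinarith),
    one_mul]

/-- Hoeffding's representation of a U-statistic. The identity needs only `p l ≠ q l`; full
disjointness of the pairs matters later, for independence. -/
theorem pairAverage_eq_sum_perm [DecidableEq ι] (f : ι → ι → ℝ) (hf : ∀ i, f i i = 0) {m : ℕ}
    (p q : Fin m → ι) (hpq : ∀ l l', p l ≠ q l') :
    m * pairAverage f = ∑ σ : Equiv.Perm ι, (Fintype.card (Equiv.Perm ι) : ℝ)⁻¹ *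
      ∑ l, f (σ (p l)) (σ (q l)) := by
  have hN : (Fintype.card (Equiv.Perm ι) : ℝ) ≠ 0 := by
    exact_mod_cast Fintype.card_ne_zero
  rw [← Finset.mul_sum, Finset.sum_comm,
    Finset.sum_congr rfl fun l _ => sum_perm_apply_eq_pairAverage f hf (hpq l l)]
  simp
  field_simp

theorem exists_disjoint_injective_pair {m : ℕ} (hm : 2 * m ≤ Fintype.card ι) :
    ∃ p q : Fin m → ι, Function.Injective p ∧ Function.Injective q ∧ ∀ l l', p l ≠ q l' := by
  let e := (Fintype.equivFin ι).symm
  refine ⟨fun l => e ⟨2 * l, by omega⟩, fun l => e ⟨2 * l + 1, by omega⟩, ?_, ?_, ?_⟩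
  · intro l l' h
    have := e.injective h
    simp only [Fin.mk.injEq] at this
    exact Fin.ext (by omega)
  · intro l l' h
    have := e.injective h
    simp only [Fin.mk.injEq] at this
    exact Fin.ext (by omega)
  · intro l l' h
    have := e.injective h
    simp only [Fin.mk.injEq] at this
    omega

theorem pairAverage_nonneg {f : ι → ι → ℝ} (hf : ∀ i j, 0 ≤ f i j) : 0 ≤ pairAverage f := by
  rcases Nat.eq_zero_or_pos (Fintype.card ι) with h | h
  · simp [pairAverage, h]
  · have h1 : (1 : ℝ) ≤ Fintype.card ι := by exact_mod_cast h
    exact mul_nonneg (inv_nonneg.mpr (mul_nonneg (by linarith) (by linarith)))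
      (Finset.sum_nonneg fun i _ => Finset.sum_nonneg fun j _ => hf i j)

/-- Half the pair average of the squared differences is the sample variance. -/
theorem pairAverage_sq_sub (x : ι → ℝ) (hn : 2 ≤ Fintype.card ι) :
    pairAverage (fun i j => (x i - x j) ^ 2 / 2) =
      ((Fintype.card ι : ℝ) - 1)⁻¹ *
        ∑ i, (x i - (Fintype.card ι : ℝ)⁻¹ * ∑ j, x j) ^ 2 := by
  have hn' : (2 : ℝ) ≤ Fintype.card ι := by exact_mod_cast hn
  have h0 : (Fintype.card ι : ℝ) ≠ 0 := by linarith
  have h1 : (Fintype.card ι : ℝ) - 1 ≠ 0 := by linarith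
  have hL : ∑ i, ∑ j, (x i - x j) ^ 2 / 2 =
      (Fintype.card ι : ℝ) * ∑ i, x i ^ 2 - (∑ i, x i) ^ 2 := by
    have h2 : ∀ i j, (x i - x j) ^ 2 / 2 = x i ^ 2 / 2 + x j ^ 2 / 2 - x i * x j := by
      intro i j; ring
    simp_rw [h2, Finset.sum_sub_distrib, Finset.sum_add_distrib, ← Finset.mul_sum,
      ← Finset.sum_mul, ← Finset.sum_div]
    simp [← Finset.mul_sum]
    ring
  have hR : ∑ i, (x i - (Fintype.card ι : ℝ)⁻¹ * ∑ j, x j) ^ 2 =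
      ∑ i, x i ^ 2 - (Fintype.card ι : ℝ)⁻¹ * (∑ i, x i) ^ 2 := by
    have h2 : ∀ c : ℝ, ∑ i, (x i - c) ^ 2 =
        ∑ i, x i ^ 2 - 2 * c * ∑ i, x i + Fintype.card ι * c ^ 2 := by
      intro c
      simp_rw [sub_sq, Finset.sum_add_distrib, Finset.sum_sub_distrib, Finset.mul_sum]
      simp [mul_comm, mul_left_comm]
    rw [h2]
    field_simp
    ring
  rw [pairAverage, hL, hR]
  field_simp

end PairAverage

/-! ### Concentration of the sample variance of independent bounded random variables -/

/-- The convex function exp lies below its chord between 0 and η. -/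
theorem exp_mul_le_one_add_mul {x η : ℝ} (hx : x ∈ Set.Icc (0 : ℝ) 1) :
    Real.exp (η * x) ≤ 1 + (Real.exp η - 1) * x := by
  have h := convexOn_exp.2 (Set.mem_univ 0) (Set.mem_univ η) (sub_nonneg.mpr hx.2) hx.1
    (by ring)
  simp only [smul_eq_mul, mul_zero, zero_add, Real.exp_zero, mul_one] at h
  calc Real.exp (η * x) = Real.exp (x * η) := by rw [mul_comm]
    _ ≤ 1 - x + x * Real.exp η := h
    _ = _ := by ring

/-- Turns a deviation of standard deviations into a linear event in `w` with a fixed η, to which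
Chernoff applies. The choice exp η = (√v + r)/√v, with log ρ ≥ 1 - 1/ρ, leaves (√v + r) r - √v r =
r². -/
theorem exists_log_ratio_upper {v r : ℝ} (hv : 0 ≤ v) (hr : 0 ≤ r) :
    ∃ η : ℝ, ∀ w, 0 ≤ w → √v + r < √w → r ^ 2 ≤ η * w - (Real.exp η - 1) * v := by
  rcases hv.eq_or_lt with rfl | hv
  -- At v = 0 the ratio is undefined, but the term with exp η disappears, so η = 1 suffices.
  · refine ⟨1, fun w hw h => ?_⟩
    rw [Real.sqrt_zero, zero_add] at h
    have := Real.sq_sqrt hw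
    nlinarith
  · have hs : 0 < √v := Real.sqrt_pos.mpr hv
    set ρ := (√v + r) / √v with hρ
    have hρ1 : 1 ≤ ρ := by rw [hρ, le_div_iff₀ hs]; linarith
    have hρ0 : 0 < ρ := by linarith
    refine ⟨Real.log ρ, fun w hw h => ?_⟩
    rw [Real.exp_log hρ0]
    have hlog := Real.one_sub_inv_le_log_of_pos hρ0
    have hsv := Real.sq_sqrt hv.le
    have hx : (√v + r) ^ 2 ≤ w := by
      rw [← Real.sq_sqrt hw]; gcongr
    have h1 : (1 - ρ⁻¹) * (√v + r) ^ 2 ≤ Real.log ρ * w :=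
      mul_le_mul hlog hx (by positivity) (Real.log_nonneg hρ1)
    have h2 : (1 - ρ⁻¹) * (√v + r) ^ 2 = (√v + r) ^ 2 - √v * (√v + r) := by
      have : 0 < √v + r := by linarith
      rw [hρ]; field_simp
    have h3 : (ρ - 1) * v = √v * r := by
      rw [← hsv, hρ]; simp only [Real.sqrt_sq hs.le]; field_simp; ring
    rw [h3]
    nlinarith

theorem exists_log_ratio_lower {v r : ℝ} (hv : 0 ≤ v) (hr : 0 ≤ r) :
    ∃ η : ℝ, ∀ w, 0 ≤ w → √w < √v - r → r ^ 2 ≤ η * w - (Real.exp η - 1) * v := by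
  rcases le_or_gt (√v - r) 0 with h0 | h0
  -- Here the event √w < √v - r is empty, so any η will do.
  · exact ⟨0, fun w hw h => absurd (Real.sqrt_nonneg w) (by linarith)⟩
  · have hs : 0 < √v := by linarith
    set ρ := (√v - r) / √v with hρ
    have hρ1 : ρ ≤ 1 := by rw [hρ, div_le_one hs]; linarith
    have hρ0 : 0 < ρ := by positivity
    refine ⟨Real.log ρ, fun w hw h => ?_⟩
    rw [Real.exp_log hρ0]
    have hlog := Real.one_sub_inv_le_log_of_pos hρ0
    have hsv := Real.sq_sqrt hv
    have hx : w ≤ (√v - r) ^ 2 := by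
      rw [← Real.sq_sqrt hw]; gcongr
    have h1 : (1 - ρ⁻¹) * (√v - r) ^ 2 ≤ Real.log ρ * w := by
      calc (1 - ρ⁻¹) * (√v - r) ^ 2 ≤ Real.log ρ * (√v - r) ^ 2 := by gcongr
        _ ≤ Real.log ρ * w := mul_le_mul_of_nonpos_left hx (Real.log_nonpos hρ0.le hρ1)
    have h2 : (1 - ρ⁻¹) * (√v - r) ^ 2 = (√v - r) ^ 2 - √v * (√v - r) := by
      rw [hρ]; field_simp
    have h3 : (ρ - 1) * v = - (√v * r) := by
      rw [← hsv, hρ]; simp only [Real.sqrt_sq hs.le]; field_simp; ring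
    rw [h3]
    nlinarith

theorem sq_sub_div_two_mem_Icc {Ω : Type*} [MeasurableSpace Ω] {P : Measure Ω}
    {ι : Type*} {X : ι → Ω → ℝ} {a b : ℝ} (hab : ∀ i, ∀ᵐ ω ∂P, X i ω ∈ Set.Icc a b) (i j : ι) :
    ∀ᵐ ω ∂P, (X i ω - X j ω) ^ 2 / 2 ∈ Set.Icc 0 ((b - a) ^ 2 / 2) := by
  filter_upwards [hab i, hab j] with ω hi hj
  refine ⟨by positivity, ?_⟩
  refine div_le_div_of_nonneg_right (sq_le_sq' ?_ ?_) two_pos.le <;>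
    linarith [hi.1, hi.2, hj.1, hj.2]

section

variable {Ω : Type*} [MeasurableSpace Ω] {P : Measure Ω} [IsProbabilityMeasure P]
  {ι : Type*} {X : ι → Ω → ℝ} {a b : ℝ}

/-- Disjoint pairs use disjoint sets of independent variables; the induction splits off one pair at
a time. -/
theorem integral_prod_pairs (hX : ∀ i, AEMeasurable (X i) P) (hind : iIndepFun X P)
    {κ : Type*} {p q : κ → ι} (hp : Function.Injective p) (hq : Function.Injective q)
    (hpq : ∀ l l', p l ≠ q l') {F : κ → ℝ × ℝ → ℝ} (hF : ∀ l, Measurable (F l)) (s : Finset κ) :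
    ∫ ω, ∏ l ∈ s, F l (X (p l) ω, X (q l) ω) ∂P =
      ∏ l ∈ s, ∫ ω, F l (X (p l) ω, X (q l) ω) ∂P := by
  classical
  induction s using Finset.induction_on with
  | empty => simp
  | insert l s hl ih =>
    simp_rw [Finset.prod_insert hl]
    rw [← ih]
    have hmeas : ∀ l, AEMeasurable (fun ω => F l (X (p l) ω, X (q l) ω)) P := fun l =>
      (hF l).comp_aemeasurable ((hX _).prodMk (hX _))
    refine IndepFun.integral_fun_mul_eq_mul_integral ?_ (hmeas l).aestronglyMeasurable
      (Finset.aemeasurable_fun_prod _ fun l _ => hmeas l).aestronglyMeasurable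
    have hdisj : Disjoint ({p l, q l} : Finset ι) (s.image p ∪ s.image q) := by
      rw [Finset.disjoint_left]
      intro i hi hi'
      simp only [Finset.mem_insert, Finset.mem_singleton, Finset.mem_union,
        Finset.mem_image] at hi hi'
      rcases hi with rfl | rfl <;> rcases hi' with ⟨l', hl', h⟩ | ⟨l', hl', h⟩
      · exact hl (hp h ▸ hl')
      · exact hpq _ _ h.symm
      · exact hpq _ _ h
      · exact hl (hq h ▸ hl')
    have h := hind.indepFun_finset₀ _ _ hdisj hX
    refine h.comp (φ := fun y : (({p l, q l} : Finset ι) → ℝ) =>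
        F l (y ⟨p l, by simp⟩, y ⟨q l, by simp⟩))
      (ψ := fun y : ((s.image p ∪ s.image q : Finset ι) → ℝ) => ∏ l' ∈ s.attach,
        F l' (y ⟨p l', Finset.mem_union_left _ (Finset.mem_image_of_mem p l'.2)⟩,
          y ⟨q l', Finset.mem_union_right _ (Finset.mem_image_of_mem q l'.2)⟩)) ?_ ?_ |>.congr ?_ ?_
    · exact (hF l).comp (by fun_prop)
    · exact Finset.measurable_fun_prod _ fun l' _ => (hF l').comp (by fun_prop)
    · exact Filter.EventuallyEq.rfl
    · refine Filter.Eventually.of_forall fun ω => ?_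
      exact Finset.prod_attach s (fun l' => F l' (X (p l') ω, X (q l') ω))

/-- Divided by its bound H = (b-a)²/2, the kernel lies in [0,1], so the chord bound gives a
Poisson-type exponential moment, normalized by the mean of this particular pair. No common
distribution is needed. -/
theorem integral_exp_pair_le (hX : ∀ i, AEMeasurable (X i) P)
    (hab : ∀ i, ∀ᵐ ω ∂P, X i ω ∈ Set.Icc a b) (hlt : a < b) (i j : ι) (η : ℝ) :
    ∫ ω, Real.exp (((b - a) ^ 2 / 2)⁻¹ * (η * ((X i ω - X j ω) ^ 2 / 2) -
      (Real.exp η - 1) * ∫ ω', (X i ω' - X j ω') ^ 2 / 2 ∂P)) ∂P ≤ 1 := by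
  set H := (b - a) ^ 2 / 2 with hH
  have hHpos : 0 < H := by have := sub_pos.mpr hlt; positivity
  set e := ∫ ω', (X i ω' - X j ω') ^ 2 / 2 ∂P with he
  have hmeas : AEMeasurable (fun ω => (X i ω - X j ω) ^ 2 / 2) P :=
    (((hX i).sub (hX j)).pow_const 2).div_const 2
  have hmem := sq_sub_div_two_mem_Icc hab i j
  have hint : Integrable (fun ω => (X i ω - X j ω) ^ 2 / 2) P :=
    Integrable.of_mem_Icc _ _ hmeas hmem
  have hle : ∀ᵐ ω ∂P, Real.exp (H⁻¹ * (η * ((X i ω - X j ω) ^ 2 / 2) - (Real.exp η - 1) * e)) ≤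
      Real.exp (-((Real.exp η - 1) * (e * H⁻¹))) *
        (1 + (Real.exp η - 1) * (((X i ω - X j ω) ^ 2 / 2) * H⁻¹)) := by
    filter_upwards [hmem] with ω h
    have hsplit : H⁻¹ * (η * ((X i ω - X j ω) ^ 2 / 2) - (Real.exp η - 1) * e) =
        -((Real.exp η - 1) * (e * H⁻¹)) + η * (((X i ω - X j ω) ^ 2 / 2) * H⁻¹) := by ring
    rw [hsplit, Real.exp_add]
    refine mul_le_mul_of_nonneg_left (exp_mul_le_one_add_mul ⟨?_, ?_⟩) (Real.exp_nonneg _)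
    · exact mul_nonneg h.1 (inv_nonneg.mpr hHpos.le)
    · rw [← div_eq_mul_inv, div_le_one hHpos]; exact h.2
  have hint1 : Integrable (fun ω => (Real.exp η - 1) * (((X i ω - X j ω) ^ 2 / 2) * H⁻¹)) P :=
    (hint.mul_const _).const_mul _
  have hint2 : Integrable (fun ω => Real.exp (-((Real.exp η - 1) * (e * H⁻¹))) *
      (1 + (Real.exp η - 1) * (((X i ω - X j ω) ^ 2 / 2) * H⁻¹))) P :=
    ((integrable_const _).add hint1).const_mul _
  refine (integral_mono_of_nonneg (Filter.Eventually.of_forall fun ω => Real.exp_nonneg _)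
    hint2 hle).trans ?_
  rw [integral_const_mul, integral_add (integrable_const _) hint1, integral_const_mul,
    integral_mul_const, ← he]
  simp only [integral_const, probReal_univ, smul_eq_mul, mul_one]
  calc _ ≤ Real.exp (-((Real.exp η - 1) * (e * H⁻¹))) * Real.exp ((Real.exp η - 1) * (e * H⁻¹)) := by
        gcongr
        rw [add_comm]; exact Real.add_one_le_exp _
    _ = 1 := by rw [← Real.exp_add]; simp

variable [Fintype ι]

/-- For each permutation the exponential factors over independent pairs, each factor having integral
at most 1; Jensen's inequality then passes to the average over permutations. -/
theorem integral_exp_pairAverage_le_one (hX : ∀ i, AEMeasurable (X i) P)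
    (hab : ∀ i, ∀ᵐ ω ∂P, X i ω ∈ Set.Icc a b) (hind : iIndepFun X P) (hlt : a < b)
    {m : ℕ} (hm : 2 * m ≤ Fintype.card ι) (η : ℝ) :
    Integrable (fun ω => Real.exp (((b - a) ^ 2 / 2)⁻¹ * m *
      (η * pairAverage (fun i j => (X i ω - X j ω) ^ 2 / 2) - (Real.exp η - 1) *
        pairAverage (fun i j => ∫ ω', (X i ω' - X j ω') ^ 2 / 2 ∂P)))) P ∧
    ∫ ω, Real.exp (((b - a) ^ 2 / 2)⁻¹ * m *
      (η * pairAverage (fun i j => (X i ω - X j ω) ^ 2 / 2) - (Real.exp η - 1) *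
        pairAverage (fun i j => ∫ ω', (X i ω' - X j ω') ^ 2 / 2 ∂P))) ∂P ≤ 1 := by
  classical
  obtain ⟨p, q, hp, hq, hpq⟩ := exists_disjoint_injective_pair hm
  set H := (b - a) ^ 2 / 2 with hH
  set g : ι → ι → Ω → ℝ := fun i j ω => H⁻¹ * (η * ((X i ω - X j ω) ^ 2 / 2) -
      (Real.exp η - 1) * ∫ ω', (X i ω' - X j ω') ^ 2 / 2 ∂P) with hg
  set N : ℝ := (Fintype.card (Equiv.Perm ι) : ℝ) with hN
  have hNpos : 0 < N := by
    rw [hN]; exact_mod_cast Fintype.card_pos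
  have hrep : ∀ ω, H⁻¹ * m * (η * pairAverage (fun i j => (X i ω - X j ω) ^ 2 / 2) -
      (Real.exp η - 1) * pairAverage (fun i j => ∫ ω', (X i ω' - X j ω') ^ 2 / 2 ∂P)) =
      ∑ σ : Equiv.Perm ι, N⁻¹ * ∑ l, g (σ (p l)) (σ (q l)) ω := by
    intro ω
    have h1 := pairAverage_eq_sum_perm (fun i j => (X i ω - X j ω) ^ 2 / 2) (by simp) p q hpq
    have h2 := pairAverage_eq_sum_perm (fun i j => ∫ ω', (X i ω' - X j ω') ^ 2 / 2 ∂P)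
      (by simp) p q hpq
    calc _ = H⁻¹ * (η * (m * pairAverage (fun i j => (X i ω - X j ω) ^ 2 / 2)) -
        (Real.exp η - 1) * (m * pairAverage (fun i j => ∫ ω', (X i ω' - X j ω') ^ 2 / 2 ∂P))) := by
          ring
      _ = _ := by
        rw [h1, h2]
        simp only [hg, ← Finset.mul_sum, Finset.sum_sub_distrib]
        ring
  have hgmeas : ∀ i j, AEMeasurable (g i j) P := fun i j =>
    (((((hX i).sub (hX j)).pow_const 2).div_const 2).const_mul η |>.sub_const _).const_mul _
  have hgbd : ∃ C, ∀ᵐ ω ∂P, ∀ i j, |g i j ω| ≤ C := by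
    refine ⟨|H⁻¹| * (|η| * H + |Real.exp η - 1| * H), ?_⟩
    have hall : ∀ᵐ ω ∂P, ∀ i j, (X i ω - X j ω) ^ 2 / 2 ∈ Set.Icc 0 H :=
      ae_all_iff.mpr fun i => ae_all_iff.mpr fun j => sq_sub_div_two_mem_Icc hab i j
    filter_upwards [hall] with ω h i j
    have hmean := integral_mem_Icc ((((hX i).sub (hX j)).pow_const 2).div_const 2)
      (sq_sub_div_two_mem_Icc hab i j)
    rw [hg]
    simp only
    rw [abs_mul]
    gcongr
    refine (abs_sub _ _).trans ?_
    rw [abs_mul, abs_mul]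
    gcongr
    · rw [abs_of_nonneg (h i j).1]; exact (h i j).2
    · simp only [Pi.sub_apply] at hmean
      rw [abs_of_nonneg hmean.1]; exact hmean.2
  obtain ⟨C, hC⟩ := hgbd
  have hsumint : ∀ σ : Equiv.Perm ι,
      Integrable (fun ω => Real.exp (∑ l, g (σ (p l)) (σ (q l)) ω)) P := by
    intro σ
    refine integrable_exp_of_ae_mem_Icc (a := -∑ _l : Fin m, C) (b := ∑ _l : Fin m, C)
      (Finset.aemeasurable_fun_sum _ fun l _ => hgmeas _ _) ?_
    filter_upwards [hC] with ω h
    exact abs_le.mp ((Finset.abs_sum_le_sum_abs _ _).trans (Finset.sum_le_sum fun l _ => h _ _))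
  have hblock : ∀ σ : Equiv.Perm ι,
      ∫ ω, Real.exp (∑ l, g (σ (p l)) (σ (q l)) ω) ∂P ≤ 1 := by
    intro σ
    have h := integral_prod_pairs hX hind (p := fun l => σ (p l)) (q := fun l => σ (q l))
      (σ.injective.comp hp) (σ.injective.comp hq) (fun l l' h => hpq l l' (σ.injective h))
      (F := fun l z => Real.exp (H⁻¹ * (η * ((z.1 - z.2) ^ 2 / 2) - (Real.exp η - 1) *
        ∫ ω', (X (σ (p l)) ω' - X (σ (q l)) ω') ^ 2 / 2 ∂P))) (fun l => by fun_prop) Finset.univ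
    simp_rw [Real.exp_sum]
    rw [h]
    exact Finset.prod_le_one (fun l _ => integral_nonneg fun ω => Real.exp_nonneg _)
      fun l _ => integral_exp_pair_le hX hab hlt _ _ η
  simp_rw [hrep]
  have hjensen : ∀ ω, Real.exp (∑ σ : Equiv.Perm ι, N⁻¹ * ∑ l, g (σ (p l)) (σ (q l)) ω) ≤
      ∑ σ : Equiv.Perm ι, N⁻¹ * Real.exp (∑ l, g (σ (p l)) (σ (q l)) ω) := by
    intro ω
    have h := convexOn_exp.map_sum_le (t := (Finset.univ : Finset (Equiv.Perm ι)))
      (w := fun _ => N⁻¹) (p := fun σ => ∑ l, g (σ (p l)) (σ (q l)) ω)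
      (fun _ _ => inv_nonneg.mpr hNpos.le) (by simp [hN]) (fun _ _ => Set.mem_univ _)
    simpa only [smul_eq_mul] using h
  have hmajor : Integrable (fun ω => ∑ σ : Equiv.Perm ι,
      N⁻¹ * Real.exp (∑ l, g (σ (p l)) (σ (q l)) ω)) P :=
    integrable_finsetSum _ fun σ _ => (hsumint σ).const_mul _
  have hint : Integrable (fun ω => Real.exp (∑ σ : Equiv.Perm ι,
      N⁻¹ * ∑ l, g (σ (p l)) (σ (q l)) ω)) P := by
    refine hmajor.mono' ?_ (Filter.Eventually.of_forall fun ω => ?_)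
    · exact (Real.measurable_exp.comp_aemeasurable (Finset.aemeasurable_fun_sum _ fun σ _ =>
        (Finset.aemeasurable_fun_sum _ fun l _ => hgmeas _ _).const_mul _)).aestronglyMeasurable
    · rw [Real.norm_of_nonneg (Real.exp_nonneg _)]; exact hjensen ω
  refine ⟨hint, (integral_mono hint hmajor hjensen).trans ?_⟩
  rw [integral_finsetSum _ fun σ _ => (hsumint σ).const_mul _]
  simp_rw [integral_const_mul]
  calc _ ≤ ∑ _σ : Equiv.Perm ι, N⁻¹ * 1 := by
        gcongr with σ
        exact hblock σ
    _ = 1 := by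
        simp [hN]

theorem measure_pairAverage_ge_le (hX : ∀ i, AEMeasurable (X i) P)
    (hab : ∀ i, ∀ᵐ ω ∂P, X i ω ∈ Set.Icc a b) (hind : iIndepFun X P) (hlt : a < b)
    {m : ℕ} (hm : 2 * m ≤ Fintype.card ι) (η r : ℝ) :
    P.real {ω | r ^ 2 ≤ η * pairAverage (fun i j => (X i ω - X j ω) ^ 2 / 2) - (Real.exp η - 1) *
        pairAverage (fun i j => ∫ ω', (X i ω' - X j ω') ^ 2 / 2 ∂P)} ≤
      Real.exp (-(((b - a) ^ 2 / 2)⁻¹ * m * r ^ 2)) := by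
  obtain ⟨hint, hle⟩ := integral_exp_pairAverage_le_one hX hab hind hlt hm η
  have h := mul_meas_ge_le_integral_of_nonneg
    (Filter.Eventually.of_forall fun ω => Real.exp_nonneg _) hint
    (Real.exp (((b - a) ^ 2 / 2)⁻¹ * m * r ^ 2))
  rw [Real.exp_neg, ← one_div, le_div_iff₀ (Real.exp_pos _), mul_comm]
  refine le_trans ?_ (h.trans hle)
  refine mul_le_mul_of_nonneg_left (measureReal_mono fun ω hω => ?_) (Real.exp_nonneg _)
  simp only [Set.mem_ofPred_eq, Real.exp_le_exp] at hω ⊢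
  gcongr

/-- Lower and upper tail of the sample standard deviation. -/
theorem measure_sqrt_pairAverage_lt_le (hX : ∀ i, AEMeasurable (X i) P)
    (hab : ∀ i, ∀ᵐ ω ∂P, X i ω ∈ Set.Icc a b) (hind : iIndepFun X P) (hlt : a < b)
    (hn : 2 ≤ Fintype.card ι) {L : ℝ} (hL : 0 ≤ L) :
    P.real {ω | √(pairAverage (fun i j => (X i ω - X j ω) ^ 2 / 2)) <
      √(pairAverage (fun i j => ∫ ω', (X i ω' - X j ω') ^ 2 / 2 ∂P)) -
        (b - a) * √(L / ((Fintype.card ι : ℝ) - 1))} ≤ Real.exp (-L) ∧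
    P.real {ω | √(pairAverage (fun i j => ∫ ω', (X i ω' - X j ω') ^ 2 / 2 ∂P)) +
        (b - a) * √(L / ((Fintype.card ι : ℝ) - 1)) <
      √(pairAverage (fun i j => (X i ω - X j ω) ^ 2 / 2))} ≤ Real.exp (-L) := by
  have hM := sub_pos.mpr hlt
  have hn' : (2 : ℝ) ≤ Fintype.card ι := by exact_mod_cast hn
  have hn1 : 0 < (Fintype.card ι : ℝ) - 1 := by linarith
  set r := (b - a) * √(L / ((Fintype.card ι : ℝ) - 1)) with hr
  have hr0 : 0 ≤ r := by positivity
  set v := pairAverage (fun i j => ∫ ω', (X i ω' - X j ω') ^ 2 / 2 ∂P) with hv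
  have hv0 : 0 ≤ v := pairAverage_nonneg fun i j => integral_nonneg fun ω => by positivity
  have hw0 : ∀ ω, 0 ≤ pairAverage (fun i j => (X i ω - X j ω) ^ 2 / 2) := fun ω =>
    pairAverage_nonneg fun i j => by positivity
  have hm : 2 * (Fintype.card ι / 2) ≤ Fintype.card ι := Nat.mul_div_le _ _
  -- With this `r` the exponent is L * 2⌊n/2⌋ / (n-1), and 2⌊n/2⌋ ≥ n - 1; this is why the deviation
  -- carries n - 1.
  have hexp : Real.exp (-(((b - a) ^ 2 / 2)⁻¹ * (Fintype.card ι / 2 : ℕ) * r ^ 2)) ≤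
      Real.exp (-L) := by
    rw [Real.exp_le_exp, neg_le_neg_iff, hr, mul_pow, Real.sq_sqrt (by positivity)]
    have hm2 : (Fintype.card ι : ℝ) - 1 ≤ 2 * (Fintype.card ι / 2 : ℕ) := by
      have : Fintype.card ι ≤ 2 * (Fintype.card ι / 2) + 1 := by omega
      have : (Fintype.card ι : ℝ) ≤ 2 * (Fintype.card ι / 2 : ℕ) + 1 := by exact_mod_cast this
      linarith
    have heq : ((b - a) ^ 2 / 2)⁻¹ * (Fintype.card ι / 2 : ℕ) *
        ((b - a) ^ 2 * (L / ((Fintype.card ι : ℝ) - 1))) =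
        L * (2 * (Fintype.card ι / 2 : ℕ)) / ((Fintype.card ι : ℝ) - 1) := by
      field_simp
    rw [heq, le_div_iff₀ hn1]
    gcongr
  obtain ⟨η₁, h₁⟩ := exists_log_ratio_lower hv0 hr0
  obtain ⟨η₂, h₂⟩ := exists_log_ratio_upper hv0 hr0
  constructor
  · refine le_trans (measureReal_mono fun ω hω => ?_)
      ((measure_pairAverage_ge_le hX hab hind hlt hm η₁ r).trans hexp)
    exact h₁ _ (hw0 ω) hω
  · refine le_trans (measureReal_mono fun ω hω => ?_)
      ((measure_pairAverage_ge_le hX hab hind hlt hm η₂ r).trans hexp)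
    exact h₂ _ (hw0 ω) hω

end

/-! ### The empirical Bernstein inequality -/

section

variable {Ω : Type*} [MeasurableSpace Ω] {P : Measure Ω} [IsProbabilityMeasure P]
  {ι : Type*} {X : ι → Ω → ℝ} {a b : ℝ}

theorem integral_sq_sub_div_two (hX : ∀ i, AEMeasurable (X i) P)
    (hab : ∀ i, ∀ᵐ ω ∂P, X i ω ∈ Set.Icc a b) (hind : iIndepFun X P) {i j : ι} (hij : i ≠ j) :
    ∫ ω, (X i ω - X j ω) ^ 2 / 2 ∂P = (Var[X i; P] + Var[X j; P]) / 2 +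
      ((∫ ω, X i ω ∂P) - ∫ ω, X j ω ∂P) ^ 2 / 2 := by
  have hLi := memLp_of_ae_mem_Icc (hX i) (hab i)
  have hLj := memLp_of_ae_mem_Icc (hX j) (hab j)
  have h1 := variance_sub hLi hLj
  rw [(hind.indepFun hij).covariance_eq_zero hLi hLj, variance_eq_sub (hLi.sub hLj)] at h1
  have h2 : ∫ ω, (X i - X j) ω ∂P = (∫ ω, X i ω ∂P) - ∫ ω, X j ω ∂P :=
    integral_sub (hLi.integrable one_le_two) (hLj.integrable one_le_two)
  have h3 : ∫ ω, ((X i - X j) ^ 2) ω ∂P = ∫ ω, (X i ω - X j ω) ^ 2 ∂P := rfl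
  rw [h2, h3] at h1
  rw [integral_div]
  linarith

variable [Fintype ι]

/-- The expected sample variance is the average variance plus a bias measuring how much the means
differ. The diagonal vanishes on the left, so its variance is subtracted explicitly in `hterm`. -/
theorem pairAverage_integral_sq_sub (hX : ∀ i, AEMeasurable (X i) P)
    (hab : ∀ i, ∀ᵐ ω ∂P, X i ω ∈ Set.Icc a b) (hind : iIndepFun X P)
    (hn : 2 ≤ Fintype.card ι) :
    pairAverage (fun i j => ∫ ω, (X i ω - X j ω) ^ 2 / 2 ∂P) =
      (Fintype.card ι : ℝ)⁻¹ * ∑ i, Var[X i; P] +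
        pairAverage (fun i j => ((∫ ω, X i ω ∂P) - ∫ ω, X j ω ∂P) ^ 2 / 2) := by
  classical
  have hn' : (2 : ℝ) ≤ Fintype.card ι := by exact_mod_cast hn
  have h0 : (Fintype.card ι : ℝ) ≠ 0 := by linarith
  have h1 : (Fintype.card ι : ℝ) - 1 ≠ 0 := by linarith
  have hterm : ∀ i j, ∫ ω, (X i ω - X j ω) ^ 2 / 2 ∂P =
      (Var[X i; P] / 2 + Var[X j; P] / 2) - (if i = j then Var[X i; P] else 0) +
        ((∫ ω, X i ω ∂P) - ∫ ω, X j ω ∂P) ^ 2 / 2 := by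
    intro i j
    by_cases hij : i = j
    · subst hij; simp
    · rw [integral_sq_sub_div_two hX hab hind hij, if_neg hij]; ring
  have hsum : ∑ i, ∑ j, ∫ ω, (X i ω - X j ω) ^ 2 / 2 ∂P =
      ((Fintype.card ι : ℝ) - 1) * ∑ i, Var[X i; P] +
        ∑ i, ∑ j, ((∫ ω, X i ω ∂P) - ∫ ω, X j ω ∂P) ^ 2 / 2 := by
    simp_rw [hterm, Finset.sum_add_distrib, Finset.sum_sub_distrib, Finset.sum_add_distrib]
    simp [← Finset.mul_sum, ← Finset.sum_div]
    ring
  rw [pairAverage, hsum, pairAverage]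
  field_simp

theorem pairAverage_sq_sub_le {x : ι → ℝ} {c D : ℝ} (hn : 2 ≤ Fintype.card ι)
    (hx : ∀ i, |x i - c| ≤ D) : pairAverage (fun i j => (x i - x j) ^ 2 / 2) ≤ 2 * D ^ 2 := by
  classical
  have hn' : (2 : ℝ) ≤ Fintype.card ι := by exact_mod_cast hn
  have hpos : 0 < (Fintype.card ι : ℝ) * ((Fintype.card ι : ℝ) - 1) :=
    mul_pos (by linarith) (by linarith)
  have hterm : ∀ i j, (x i - x j) ^ 2 / 2 ≤ 2 * D ^ 2 - if i = j then 2 * D ^ 2 else 0 := by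
    intro i j
    split_ifs with hij
    · simp [hij]
    · have hi := abs_le.mp (hx i)
      have hj := abs_le.mp (hx j)
      have : (x i - x j) ^ 2 ≤ (2 * D) ^ 2 := sq_le_sq' (by linarith) (by linarith)
      linarith
  have hsum : ∑ i, ∑ j, (x i - x j) ^ 2 / 2 ≤
      (Fintype.card ι : ℝ) * ((Fintype.card ι : ℝ) - 1) * (2 * D ^ 2) := by
    refine (Finset.sum_le_sum fun i _ => Finset.sum_le_sum fun j _ => hterm i j).trans ?_
    simp [Finset.sum_sub_distrib]
    apply le_of_eq
    ring
  rw [pairAverage, inv_mul_le_iff₀ hpos]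
  exact hsum

theorem measure_abs_sum_sub_integral_gt_le (hX : ∀ i, AEMeasurable (X i) P)
    (hab : ∀ i, ∀ᵐ ω ∂P, X i ω ∈ Set.Icc a b) (hind : iIndepFun X P) (hlt : a < b)
    {L : ℝ} (hL : 0 < L) :
    P.real {ω | √(2 * (∑ i, Var[X i; P]) * L) + 6 / 5 * (b - a) * L <
      |∑ i, (X i ω - ∫ ω', X i ω' ∂P)|} ≤ 2 * Real.exp (-L) := by
  have hup := measure_sum_sub_integral_ge_le hX hab hind hlt hL
  have hlow := measure_sum_sub_integral_ge_le (X := fun i ω => -X i ω) (a := -b) (b := -a)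
    (fun i => (hX i).neg)
    (fun i => (hab i).mono fun ω h => ⟨neg_le_neg h.2, neg_le_neg h.1⟩)
    (hind.comp (fun _ x => -x) fun _ => measurable_neg) (neg_lt_neg hlt) hL
  have hvar : ∀ i, Var[fun ω => -X i ω; P] = Var[X i; P] := fun i => variance_fun_neg
  simp_rw [hvar, integral_neg, neg_sub_neg] at hlow
  have htwo : 2 * Real.exp (-L) = Real.exp (-L) + Real.exp (-L) := two_mul _
  rw [htwo]
  refine le_trans (measureReal_mono ?_ (measure_ne_top _ _)) ((measureReal_union_le _ _).trans (add_le_add hup hlow))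
  intro ω hω
  simp only [Set.mem_ofPred_eq] at hω
  rcases lt_abs.mp hω with h | h
  · exact Or.inl h.le
  · refine Or.inr ?_
    rw [← Finset.sum_neg_distrib] at h
    simp_rw [neg_sub] at h
    exact h.le

/-- The empirical Bernstein inequality for independent bounded random variables that need not be
identically distributed, together with an upper bound for the sample standard deviation. -/
theorem measure_empirical_bernstein_le (hX : ∀ i, AEMeasurable (X i) P)
    (hab : ∀ i, ∀ᵐ ω ∂P, X i ω ∈ Set.Icc a b) (hind : iIndepFun X P)
    (hn : 2 ≤ Fintype.card ι) {L : ℝ} (hL : 0 < L) {c D : ℝ}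
    (hD : ∀ i, |(∫ ω, X i ω ∂P) - c| ≤ D) :
    P.real {ω | ¬ (|(Fintype.card ι : ℝ)⁻¹ * ∑ i, X i ω -
          (Fintype.card ι : ℝ)⁻¹ * ∑ i, ∫ ω', X i ω' ∂P| ≤
        √(pairAverage (fun i j => (X i ω - X j ω) ^ 2 / 2)) * √(2 * L / Fintype.card ι) +
          8 * (b - a) * L / (3 * ((Fintype.card ι : ℝ) - 1)) ∧
      √(pairAverage (fun i j => (X i ω - X j ω) ^ 2 / 2)) ≤
        √((Fintype.card ι : ℝ)⁻¹ * ∑ i, Var[X i; P]) + √2 * D +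
          (b - a) * √(L / ((Fintype.card ι : ℝ) - 1)))} ≤ 4 * Real.exp (-L) := by
  have hn' : (2 : ℝ) ≤ Fintype.card ι := by exact_mod_cast hn
  have hne : Nonempty ι := Fintype.card_pos_iff.mp (by omega)
  set n : ℝ := (Fintype.card ι : ℝ) with hndef
  have hn1 : 0 < n - 1 := by linarith
  have hD0 : 0 ≤ D := (abs_nonneg _).trans (hD hne.some)
  have hle : a ≤ b := by
    obtain ⟨ω, h⟩ := (hab hne.some).exists
    exact h.1.trans h.2
  -- The tail bounds require a < b; if a = b all samples are almost surely constant and the bad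
  -- event is null.
  rcases hle.eq_or_lt with rfl | hlt
  · refine le_of_eq_of_le ?_ (by positivity : 0 ≤ 4 * Real.exp (-L))
    have hX' : ∀ᵐ ω ∂P, ∀ i, X i ω = a := by
      filter_upwards [ae_all_iff.mpr hab] with ω h i
      exact le_antisymm (h i).2 (h i).1
    have hm : ∀ i, ∫ ω, X i ω ∂P = a := fun i => by
      have h := integral_mem_Icc (hX i) (hab i)
      exact le_antisymm h.2 h.1
    rw [measureReal_eq_zero_iff]
    refine measure_mono_null (fun ω hω => ?_) (ae_iff.mp hX')
    by_contra hnot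
    have h : ∀ i, X i ω = a := not_not.mp hnot
    refine hω ?_
    have hV : pairAverage (fun i j => (X i ω - X j ω) ^ 2 / 2) = 0 := by simp [pairAverage, h]
    rw [hV]
    simp only [h, hm, sub_self, abs_zero, Real.sqrt_zero, zero_mul, mul_zero, zero_div, add_zero,
      le_refl, true_and]
    positivity
  · have hM := sub_pos.mpr hlt
    set V := fun ω => pairAverage (fun i j => (X i ω - X j ω) ^ 2 / 2) with hV
    set v := pairAverage (fun i j => ∫ ω', (X i ω' - X j ω') ^ 2 / 2 ∂P) with hv
    set s2 := n⁻¹ * ∑ i, Var[X i; P] with hs2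
    have hs20 : 0 ≤ s2 := mul_nonneg (by positivity) (Finset.sum_nonneg fun i _ => variance_nonneg _ _)
    have hdecomp := pairAverage_integral_sq_sub hX hab hind hn
    rw [← hv, ← hndef, ← hs2] at hdecomp
    have hbias := pairAverage_sq_sub_le hn hD
    have hbias0 : 0 ≤ pairAverage (fun i j => ((∫ ω, X i ω ∂P) - ∫ ω, X j ω ∂P) ^ 2 / 2) :=
      pairAverage_nonneg fun i j => by positivity
    have hsv : √s2 ≤ √v := Real.sqrt_le_sqrt (by linarith)
    have hvs : √v ≤ √s2 + √2 * D := by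
      rw [Real.sqrt_le_left (by positivity), add_sq, Real.sq_sqrt hs20, mul_pow,
        Real.sq_sqrt zero_le_two]
      have : 0 ≤ 2 * √s2 * (√2 * D) := by positivity
      linarith
    obtain ⟨hlow, hup⟩ := measure_sqrt_pairAverage_lt_le hX hab hind hlt hn hL.le
    have hmean := measure_abs_sum_sub_integral_gt_le hX hab hind hlt hL
    have htot : (4 : ℝ) * Real.exp (-L) = 2 * Real.exp (-L) + (Real.exp (-L) + Real.exp (-L)) := by
      ring
    rw [htot]
    refine le_trans (measureReal_mono ?_ (measure_ne_top _ _)) ((measureReal_union_le _ _).trans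
      (add_le_add hmean ((measureReal_union_le _ _).trans (add_le_add hlow hup))))
    intro ω hω
    by_contra hnot
    simp only [Set.mem_union, Set.mem_ofPred_eq, not_or, not_lt] at hnot
    obtain ⟨h1, h2, h3⟩ := hnot
    refine hω ⟨?_, ?_⟩
    · have hsplit : n⁻¹ * ∑ i, X i ω - n⁻¹ * ∑ i, ∫ ω', X i ω' ∂P =
          n⁻¹ * ∑ i, (X i ω - ∫ ω', X i ω' ∂P) := by
        rw [Finset.sum_sub_distrib]; ring
      rw [hsplit, abs_mul, abs_of_nonneg (by positivity : 0 ≤ n⁻¹)]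
      have hσ : n⁻¹ * √(2 * (∑ i, Var[X i; P]) * L) = √s2 * √(2 * L / n) := by
        rw [← Real.sqrt_mul hs20]
        have hni : n⁻¹ = √(n⁻¹ ^ 2) := (Real.sqrt_sq (by positivity)).symm
        have hmul : n⁻¹ * √(2 * (∑ i, Var[X i; P]) * L) =
            √(n⁻¹ ^ 2 * (2 * (∑ i, Var[X i; P]) * L)) := by
          rw [Real.sqrt_mul (x := n⁻¹ ^ 2) (by positivity), ← hni]
        rw [hmul]
        congr 1
        rw [hs2]
        field_simp
      -- Since √s2 ≤ √v, the bias in `v` only helps this direction.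
      have hs : √s2 ≤ √(V ω) + (b - a) * √(L / (n - 1)) := by
        have : √v - (b - a) * √(L / (n - 1)) ≤ √(V ω) := h2
        linarith
      -- The factor 1.42 rounds √2 up; with the 6/5 from Bernstein it makes 2.62, below the 8/3 in
      -- ψ̂.
      have hprod : √(L / (n - 1)) * √(2 * L / n) ≤ 142 / 100 * L / (n - 1) := by
        rw [← Real.sqrt_mul (by positivity), Real.sqrt_le_left (by positivity)]
        rw [div_mul_div_comm, div_pow, div_le_div_iff₀ (by positivity) (by positivity)]
        have : L * (2 * L) * (n - 1) ^ 2 = L ^ 2 * (n - 1) * (2 * (n - 1)) := by ring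
        rw [this]
        have : (142 / 100 * L) ^ 2 * ((n - 1) * n) = L ^ 2 * (n - 1) * ((142 / 100) ^ 2 * n) := by
          ring
        rw [this]
        refine mul_le_mul_of_nonneg_left ?_ (by positivity)
        linarith
      calc n⁻¹ * |∑ i, (X i ω - ∫ ω', X i ω' ∂P)|
          ≤ n⁻¹ * (√(2 * (∑ i, Var[X i; P]) * L) + 6 / 5 * (b - a) * L) := by gcongr
        _ = √s2 * √(2 * L / n) + 6 / 5 * (b - a) * L / n := by rw [mul_add, hσ]; ring
        _ ≤ (√(V ω) + (b - a) * √(L / (n - 1))) * √(2 * L / n) +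
              6 / 5 * (b - a) * L / (n - 1) := by
            gcongr
            linarith
        _ = √(V ω) * √(2 * L / n) + (b - a) * (√(L / (n - 1)) * √(2 * L / n)) +
              6 / 5 * (b - a) * L / (n - 1) := by ring
        _ ≤ √(V ω) * √(2 * L / n) + (b - a) * (142 / 100 * L / (n - 1)) +
              6 / 5 * (b - a) * L / (n - 1) := by gcongr
        _ = √(V ω) * √(2 * L / n) + 262 / 100 * ((b - a) * L / (n - 1)) := by ring
        _ ≤ √(V ω) * √(2 * L / n) + 8 / 3 * ((b - a) * L / (n - 1)) := by
            refine add_le_add_right (mul_le_mul_of_nonneg_right (by norm_num) (by positivity)) _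
        _ = _ := by
            simp only [hV]
            field_simp
    · have : √(V ω) ≤ √v + (b - a) * √(L / (n - 1)) := h3
      linarith

end

/-! ### Window averages -/

/-- The pairs `⟨j, i⟩` that index the samples in the look-back window of length `k`. -/
def windowIndex (B : ℕ → ℕ) (t k : ℕ) : Finset (Σ _ : ℕ, ℕ) :=
  (window t k).sigma fun j => Finset.Icc 1 (B j)

/-- The mean of the window average `empMean`. -/
noncomputable def windowMean (Q : ℕ → Measure ℝ) (B : ℕ → ℕ) (t k : ℕ) : ℝ :=
  (windowSize B t k : ℝ)⁻¹ * ∑ j ∈ window t k, (B j : ℝ) * popMean Q j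

section Window

variable {B : ℕ → ℕ} {t k : ℕ} {Q : ℕ → Measure ℝ}

theorem sum_windowIndex (f : ℕ → ℕ → ℝ) :
    ∑ p : windowIndex B t k, f p.1.1 p.1.2 =
      ∑ j ∈ window t k, ∑ i ∈ Finset.Icc 1 (B j), f j i := by
  rw [Finset.sum_coe_sort (windowIndex B t k) (fun p => f p.1 p.2), windowIndex, Finset.sum_sigma]

theorem sum_windowIndex_fst (f : ℕ → ℝ) :
    ∑ p : windowIndex B t k, f p.1.1 = ∑ j ∈ window t k, (B j : ℝ) * f j := by
  rw [sum_windowIndex (fun j _ => f j)]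
  simp

theorem card_windowIndex : Fintype.card (windowIndex B t k) = windowSize B t k := by
  rw [Fintype.card_coe, windowIndex, Finset.card_sigma, windowSize]
  simp

theorem window_subset : window t k ⊆ Finset.Icc 1 t := by
  intro j hj
  simp only [window, Finset.mem_Icc] at hj ⊢
  omega

theorem window_mono {i : ℕ} (hik : i ≤ k) : window t i ⊆ window t k := by
  intro j hj
  simp only [window, Finset.mem_Icc] at hj ⊢
  omega

theorem self_mem_window (hk : k ∈ Finset.Icc 1 t) : t ∈ window t k := by
  simp only [window, Finset.mem_Icc] at hk ⊢
  omega

theorem windowIndex_subset : windowIndex B t k ⊆ sampleIndex B t :=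
  Finset.sigma_mono window_subset fun _ => subset_rfl

theorem windowSize_pos (hB : ∀ j ∈ Finset.Icc 1 t, 1 ≤ B j) (hk : k ∈ Finset.Icc 1 t) :
    1 ≤ windowSize B t k := by
  have ht := self_mem_window hk
  exact (hB t (window_subset ht)).trans
    (Finset.single_le_sum (f := B) (fun _ _ => Nat.zero_le _) ht)

theorem abs_popMean_sub_le_phi {j : ℕ} (hj : j ∈ window t k) :
    |popMean Q j - popMean Q t| ≤ phi Q t k :=
  le_ciSup (f := fun j : window t k => |popMean Q j - popMean Q t|)
    (Set.finite_range _).bddAbove ⟨j, hj⟩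

theorem phi_nonneg (hk : k ∈ Finset.Icc 1 t) : 0 ≤ phi Q t k :=
  (abs_nonneg _).trans (abs_popMean_sub_le_phi (self_mem_window hk))

/-- Window means over sub-windows deviate from the current mean by at most the drift. -/
theorem abs_windowMean_sub_le_phi (hB : ∀ j ∈ Finset.Icc 1 t, 1 ≤ B j) {i : ℕ}
    (hi : i ∈ Finset.Icc 1 t) (hik : i ≤ k) :
    |windowMean Q B t i - popMean Q t| ≤ phi Q t k := by
  have hn : (0 : ℝ) < windowSize B t i := by exact_mod_cast windowSize_pos hB hi
  have hsize : (windowSize B t i : ℝ) = ∑ j ∈ window t i, (B j : ℝ) := by simp [windowSize]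
  have heq : windowMean Q B t i - popMean Q t =
      (windowSize B t i : ℝ)⁻¹ * ∑ j ∈ window t i, (B j : ℝ) * (popMean Q j - popMean Q t) := by
    simp_rw [mul_sub, Finset.sum_sub_distrib, ← Finset.sum_mul, ← hsize]
    rw [windowMean, mul_sub, inv_mul_cancel_left₀ hn.ne']
  rw [heq, abs_mul, abs_of_pos (inv_pos.mpr hn), inv_mul_le_iff₀ hn]
  refine (Finset.abs_sum_le_sum_abs _ _).trans ?_
  rw [hsize, Finset.sum_mul]
  refine Finset.sum_le_sum fun j hj => ?_
  rw [abs_mul, Nat.abs_cast]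
  exact mul_le_mul_of_nonneg_left (abs_popMean_sub_le_phi (window_mono hik hj)) (Nat.cast_nonneg _)

theorem empMean_eq (x : ℕ → ℕ → ℝ) : empMean B x t k =
    (Fintype.card (windowIndex B t k) : ℝ)⁻¹ * ∑ p : windowIndex B t k, x p.1.1 p.1.2 := by
  rw [empMean, card_windowIndex, sum_windowIndex]

theorem empStd_eq (x : ℕ → ℕ → ℝ) (hn : 2 ≤ windowSize B t k) : empStd B x t k =
    √(pairAverage (fun p q : windowIndex B t k => (x p.1.1 p.1.2 - x q.1.1 q.1.2) ^ 2 / 2)) := by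
  rw [pairAverage_sq_sub (fun p : windowIndex B t k => x p.1.1 p.1.2)
    (by rwa [card_windowIndex]), ← empMean_eq,
    sum_windowIndex (fun j i => (x j i - empMean B x t k) ^ 2), card_windowIndex, empStd]

/-! ### Selection of the window -/

/-- If every window average is within `ψ̂` of its mean, a selected window is, up to constants,
at least as good as any other window. -/
theorem abs_empMean_selected_sub_le {x : ℕ → ℕ → ℝ} {M δ' : ℝ}
    (hB : ∀ j ∈ Finset.Icc 1 t, 1 ≤ B j)
    (hgood : ∀ k ∈ Finset.Icc 1 t, |empMean B x t k - windowMean Q B t k| ≤ psiHat B x M t k δ')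
    {k' : ℕ} (hk' : k' ∈ selectedWindows B x M t δ') (hk : k ∈ Finset.Icc 1 t) :
    |empMean B x t k' - popMean Q t| ≤ 5 * phi Q t k + 3 * psiHat B x M t k δ' := by
  obtain ⟨hk't, hmin⟩ := hk'
  have hle := hmin k hk
  have hterm : ∀ k i, i ∈ Finset.Icc 1 k →
      |empMean B x t k - empMean B x t i| - (psiHat B x M t k δ' + psiHat B x M t i δ') ≤
        phiHat B x M t k δ' ∧ 0 ≤ phiHat B x M t k δ' := by
    intro k i hi
    have h := le_ciSup (f := fun i : Finset.Icc 1 k =>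
      max (|empMean B x t k - empMean B x t i| - (psiHat B x M t k δ' + psiHat B x M t i δ')) 0)
      (Set.finite_range _).bddAbove ⟨i, hi⟩
    exact ⟨(le_max_left _ _).trans h, (le_max_right _ _).trans h⟩
  have hself : ∀ k ∈ Finset.Icc 1 t, 0 ≤ phiHat B x M t k δ' := fun k hk =>
    (hterm k k (by simp only [Finset.mem_Icc] at hk ⊢; omega)).2
  -- φ̂ of the longer of the two windows sees the shorter one; adding the other φ̂ ≥ 0 makes the
  -- bound symmetric, and minimality then bounds it by 2(φ̂ + ψ̂) at `k`.
  have hcmp : |empMean B x t k' - empMean B x t k| ≤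
      phiHat B x M t k δ' + phiHat B x M t k' δ' + (psiHat B x M t k δ' + psiHat B x M t k' δ') := by
    simp only [Finset.mem_Icc] at hk hk't
    rcases le_total k k' with h | h
    · have h1 := (hterm k' k (by simp only [Finset.mem_Icc]; omega)).1
      have h2 := hself k (by simpa using hk)
      linarith
    · have h1 := (hterm k k' (by simp only [Finset.mem_Icc]; omega)).1
      have h2 := hself k' (by simpa using hk't)
      rw [abs_sub_comm]
      linarith
  have hphi : phiHat B x M t k δ' ≤ 2 * phi Q t k := by
    have : Nonempty (Finset.Icc 1 k) := ⟨⟨1, by simp only [Finset.mem_Icc] at hk ⊢; omega⟩⟩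
    refine ciSup_le fun ⟨i, hi⟩ => max_le ?_ (by linarith [phi_nonneg (Q := Q) hk])
    have hit : i ∈ Finset.Icc 1 t := by simp only [Finset.mem_Icc] at hi hk ⊢; omega
    have h1 := abs_le.mp (hgood k hk)
    have h2 := abs_le.mp (hgood i hit)
    have h3 := abs_le.mp (abs_windowMean_sub_le_phi (Q := Q) hB hk le_rfl)
    have h4 := abs_le.mp (abs_windowMean_sub_le_phi (Q := Q) hB hit (Finset.mem_Icc.mp hi).2)
    rw [sub_le_iff_le_add, abs_le]
    constructor <;> linarith
  have h1 := hgood k hk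
  have h3 := abs_windowMean_sub_le_phi (Q := Q) hB hk le_rfl
  have htri : |empMean B x t k' - popMean Q t| ≤ |empMean B x t k' - empMean B x t k| +
      |empMean B x t k - windowMean Q B t k| + |windowMean Q B t k - popMean Q t| :=
    (abs_sub_le _ (windowMean Q B t k) _).trans (by gcongr; exact abs_sub_le _ _ _)
  linarith

/-- An upper bound on the sample standard deviation turns into one for `ψ̂`. -/
theorem bernstein_radius_le {s v D M L n : ℝ} (hn : 2 ≤ n) (hD : 0 ≤ D) (hM : 0 ≤ M) (hL : 0 < L)
    (hv : v ≤ s + √2 * D + M * √(L / (n - 1))) :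
    v * √(2 * L / n) + 8 * M * L / (3 * (n - 1)) ≤
      s * √(2 * L / n) + √2 * √L * D + 10 * M * L / n := by
  have hn1 : 0 < n - 1 := by linarith
  have hn0 : 0 < n := by linarith
  have hdrift : √(2 * L / n) ≤ √L := by
    apply Real.sqrt_le_sqrt
    rw [div_le_iff₀ hn0]
    nlinarith
  have hprod : √(L / (n - 1)) * √(2 * L / n) ≤ 2 * L / n := by
    rw [← Real.sqrt_mul (by positivity), Real.sqrt_le_left (by positivity), div_mul_div_comm,
      div_pow, div_le_div_iff₀ (by positivity) (by positivity)]
    have h1 : L * (2 * L) * n ^ 2 = 2 * L ^ 2 * n * n := by ring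
    have h2 : (2 * L) ^ 2 * ((n - 1) * n) = 2 * L ^ 2 * n * (2 * (n - 1)) := by ring
    rw [h1, h2]
    refine mul_le_mul_of_nonneg_left (by linarith) (by positivity)
  -- From n ≤ 3(n - 1). Together with the 2 from `hprod` this accounts for the constant 10.
  have hlast : 8 * M * L / (3 * (n - 1)) ≤ 8 * (M * L / n) := by
    rw [← mul_div_assoc, div_le_div_iff₀ (by positivity) hn0]
    have : 0 ≤ M * L := by positivity
    nlinarith
  calc v * √(2 * L / n) + 8 * M * L / (3 * (n - 1))
      ≤ (s + √2 * D + M * √(L / (n - 1))) * √(2 * L / n) + 8 * (M * L / n) := by gcongr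
    _ = s * √(2 * L / n) + √2 * √(2 * L / n) * D + M * (√(L / (n - 1)) * √(2 * L / n)) +
          8 * (M * L / n) := by ring
    _ ≤ s * √(2 * L / n) + √2 * √L * D + M * (2 * L / n) + 8 * (M * L / n) := by gcongr
    _ = _ := by ring

end Window

/-! ### The good event -/

section Event

variable {Ω : Type*} [MeasurableSpace Ω] {P : Measure Ω} [IsProbabilityMeasure P]
  {a b : ℝ} {t : ℕ} {B : ℕ → ℕ} {Q : ℕ → Measure ℝ} {u : ℕ → ℕ → Ω → ℝ}

/-- With at least two samples this is the empirical Bernstein inequality centred at the current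
mean, with D the drift. With one sample ψ̂ = b - a covers the error almost surely, and L ≥ 1 gives
the upper bound. -/
theorem measure_not_window_good_le (hB : ∀ j ∈ Finset.Icc 1 t, 1 ≤ B j)
    (hQ : ∀ j ∈ Finset.Icc 1 t, ∀ᵐ x ∂(Q j), x ∈ Set.Icc a b)
    (hu : ∀ j ∈ Finset.Icc 1 t, ∀ i ∈ Finset.Icc 1 (B j), HasLaw (u j i) (Q j) P)
    (hind : iIndepFun (fun (p : sampleIndex B t) => u p.1.1 p.1.2) P) (hM : 0 ≤ b - a)
    {δ' : ℝ} (hL : 1 ≤ Real.log (2 / δ')) {k : ℕ} (hk : k ∈ Finset.Icc 1 t) :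
    P.real {ω | ¬ (|empMean B (fun j i => u j i ω) t k - windowMean Q B t k| ≤
          psiHat B (fun j i => u j i ω) (b - a) t k δ' ∧
        psiHat B (fun j i => u j i ω) (b - a) t k δ' ≤
          popStd Q B t k * √(2 * Real.log (2 / δ') / windowSize B t k) +
            √2 * √(Real.log (2 / δ')) * phi Q t k +
              10 * (b - a) * Real.log (2 / δ') / windowSize B t k)} ≤
      4 * Real.exp (-Real.log (2 / δ')) := by
  set L := Real.log (2 / δ') with hLdef
  have hlaw : ∀ p : windowIndex B t k, HasLaw (u p.1.1 p.1.2) (Q p.1.1) P := fun p => by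
    have hp := Finset.mem_sigma.mp (windowIndex_subset p.2)
    exact hu _ hp.1 _ hp.2
  have hX : ∀ p : windowIndex B t k, AEMeasurable (u p.1.1 p.1.2) P := fun p =>
    (hlaw p).aemeasurable
  have hab : ∀ p : windowIndex B t k, ∀ᵐ ω ∂P, u p.1.1 p.1.2 ω ∈ Set.Icc a b := fun p => by
    have hp := Finset.mem_sigma.mp (windowIndex_subset p.2)
    have h := hQ _ hp.1
    rw [← (hlaw p).map_eq] at h
    exact ae_of_ae_map (hX p) h
  have hind' : iIndepFun (fun (p : windowIndex B t k) => u p.1.1 p.1.2) P :=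
    hind.precomp (g := fun p : windowIndex B t k => (⟨p.1, windowIndex_subset p.2⟩ : sampleIndex B t))
      fun p q h => Subtype.ext (congrArg (fun z : sampleIndex B t => z.1) h)
  have hmean : ∀ p : windowIndex B t k, ∫ ω, u p.1.1 p.1.2 ω ∂P = popMean Q p.1.1 := fun p =>
    (hlaw p).integral_eq
  have hvar : ∀ p : windowIndex B t k, Var[u p.1.1 p.1.2; P] = Var[fun x : ℝ => x; Q p.1.1] :=
    fun p => (hlaw p).variance_eq
  have hwmean : windowMean Q B t k = (Fintype.card (windowIndex B t k) : ℝ)⁻¹ *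
      ∑ p : windowIndex B t k, ∫ ω, u p.1.1 p.1.2 ω ∂P := by
    simp_rw [hmean]
    rw [windowMean, card_windowIndex, sum_windowIndex_fst]
  have hstd : popStd Q B t k = √((Fintype.card (windowIndex B t k) : ℝ)⁻¹ *
      ∑ p : windowIndex B t k, Var[u p.1.1 p.1.2; P]) := by
    simp_rw [hvar]
    rw [popStd, card_windowIndex, sum_windowIndex_fst (fun j => Var[fun x : ℝ => x; Q j])]
  rcases (windowSize_pos hB hk).eq_or_lt with hn | hn
  · have hn1 : windowSize B t k = 1 := hn.symm
    refine le_of_eq_of_le ?_ (by positivity : 0 ≤ 4 * Real.exp (-L))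
    rw [measureReal_eq_zero_iff]
    refine measure_mono_null (fun ω hω => ?_) (ae_iff.mp (ae_all_iff.mpr hab))
    by_contra hnot
    have h : ∀ p : windowIndex B t k, u p.1.1 p.1.2 ω ∈ Set.Icc a b := not_not.mp hnot
    refine hω ⟨?_, ?_⟩
    · rw [psiHat, if_pos hn1, empMean_eq, hwmean, card_windowIndex, hn1, Nat.cast_one, inv_one,
        one_mul, one_mul, ← Finset.sum_sub_distrib]
      refine (Finset.abs_sum_le_sum_abs _ _).trans ?_
      have hcard : (Finset.univ : Finset (windowIndex B t k)).card = 1 := by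
        rw [Finset.card_univ, card_windowIndex, hn1]
      refine (Finset.sum_le_card_nsmul _ _ (b - a) fun p _ => ?_).trans
        (by rw [hcard, one_smul])
      have hm := integral_mem_Icc (hX p) (hab p)
      rw [abs_le]
      constructor <;> linarith [(h p).1, (h p).2, hm.1, hm.2]
    · rw [psiHat, if_pos hn1, hn1, Nat.cast_one, div_one]
      have h1 : 0 ≤ popStd Q B t k * √(2 * L / 1) := mul_nonneg (Real.sqrt_nonneg _) (Real.sqrt_nonneg _)
      have h2 : 0 ≤ √2 * √L * phi Q t k :=
        mul_nonneg (by positivity) (phi_nonneg hk)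
      rw [div_one] at h1 ⊢
      nlinarith
  · have hn2 : 2 ≤ windowSize B t k := hn
    have hn2' : (2 : ℝ) ≤ windowSize B t k := by exact_mod_cast hn2
    have hD : ∀ p : windowIndex B t k,
        |(∫ ω, u p.1.1 p.1.2 ω ∂P) - popMean Q t| ≤ phi Q t k := fun p => by
      rw [hmean]
      exact abs_popMean_sub_le_phi (Finset.mem_sigma.mp p.2).1
    refine le_trans (measureReal_mono (fun ω hω => ?_) (measure_ne_top _ _))
      (measure_empirical_bernstein_le hX hab hind' (by rwa [card_windowIndex])
        (by linarith : 0 < L) hD)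
    refine fun hgood => hω ?_
    obtain ⟨h1, h2⟩ := hgood
    rw [← empStd_eq (fun j i => u j i ω) hn2, ← hwmean, ← empMean_eq (fun j i => u j i ω),
      card_windowIndex] at h1
    rw [← empStd_eq (fun j i => u j i ω) hn2, ← hstd, card_windowIndex] at h2
    have hpsi : psiHat B (fun j i => u j i ω) (b - a) t k δ' =
        empStd B (fun j i => u j i ω) t k * √(2 * L / windowSize B t k) +
          8 * (b - a) * L / (3 * ((windowSize B t k : ℝ) - 1)) := by
      rw [psiHat, if_neg (by omega)]
    rw [hpsi]
    exact ⟨h1, bernstein_radius_le hn2' (phi_nonneg hk) hM (by linarith) h2⟩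

end Event

/-! ### Comparison of the two oracle bounds -/

/-- From log 6 = log 2 + log 3 ≥ 0.69 + 1; the value 1.69 = 1.3² serves the bound on √L in the final
estimate. -/
theorem le_log_six_mul_div {t : ℕ} (ht : 1 ≤ t) {δ : ℝ} (hδ : δ ∈ Set.Ioo (0 : ℝ) 1) :
    169 / 100 ≤ Real.log (6 * t / δ) := by
  have h6 : (169 / 100 : ℝ) ≤ Real.log 6 := by
    have h2 := Real.log_two_gt_d9
    have h3 : 1 ≤ Real.log 3 := by
      rw [Real.le_log_iff_exp_le (by norm_num)]
      exact Real.exp_one_lt_three.le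
    have : Real.log 6 = Real.log 2 + Real.log 3 := by
      rw [← Real.log_mul (by norm_num) (by norm_num)]; norm_num
    linarith
  have ht' : (1 : ℝ) ≤ t := by exact_mod_cast ht
  refine h6.trans (Real.log_le_log (by norm_num) ?_)
  rw [le_div_iff₀ hδ.1]
  nlinarith [hδ.2]

theorem popStd_le {a b : ℝ} (hM : 0 ≤ b - a) {t k : ℕ} {B : ℕ → ℕ} {Q : ℕ → Measure ℝ}
    (hB : ∀ j ∈ Finset.Icc 1 t, 1 ≤ B j) (hp : ∀ j ∈ Finset.Icc 1 t, IsProbabilityMeasure (Q j))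
    (hQ : ∀ j ∈ Finset.Icc 1 t, ∀ᵐ x ∂(Q j), x ∈ Set.Icc a b) (hk : k ∈ Finset.Icc 1 t) :
    popStd Q B t k ≤ b - a := by
  have hn : (0 : ℝ) < windowSize B t k := by exact_mod_cast windowSize_pos hB hk
  have hsize : (windowSize B t k : ℝ) = ∑ j ∈ window t k, (B j : ℝ) := by simp [windowSize]
  rw [popStd, Real.sqrt_le_left hM, inv_mul_le_iff₀ hn, hsize, Finset.sum_mul]
  refine Finset.sum_le_sum fun j hj => mul_le_mul_of_nonneg_left ?_ (Nat.cast_nonneg _)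
  have := hp j (window_subset hj)
  refine (variance_le_sq_of_bounded (hQ j (window_subset hj)) aemeasurable_id').trans ?_
  gcongr
  linarith

theorem oracle_bound_le {φ σ M L l n : ℝ} (hφ : 0 ≤ φ) (hσ : 0 ≤ σ) (hM : 0 ≤ M) (hn : 0 < n)
    (hL : 169 / 100 ≤ L) (hl : 69 / 100 ≤ l) :
    3 * (3 * √L * φ + σ * √(2 * L / n) + 10 * M * L / n) ≤
      100 * L * (φ + (σ * √(2 * l / n) + 2 * M * l / (3 * n))) := by
  have hL0 : 0 < L := by linarith
  have hl0 : 0 < l := by linarith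
  have hsqrt : √L ≤ L := by
    rw [Real.sqrt_le_left hL0.le]; nlinarith
  -- Amounts to L ≤ L² l, true because L l ≥ 1.69 · 0.69 > 1.
  have hdev : √(2 * L / n) ≤ L * √(2 * l / n) := by
    have h : L * √(2 * l / n) = √(L ^ 2 * (2 * l / n)) := by
      rw [Real.sqrt_mul (by positivity), Real.sqrt_sq hL0.le]
    rw [h]
    apply Real.sqrt_le_sqrt
    rw [← mul_div_assoc]
    refine div_le_div_of_nonneg_right ?_ hn.le
    have hLl : 1 ≤ L * l := by nlinarith
    nlinarith
  have h1 : 9 * (√L * φ) ≤ 100 * (L * φ) := by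
    have : √L * φ ≤ L * φ := by gcongr
    have : 0 ≤ L * φ := by positivity
    linarith
  have h2 : 3 * (σ * √(2 * L / n)) ≤ 100 * (σ * (L * √(2 * l / n))) := by
    have : σ * √(2 * L / n) ≤ σ * (L * √(2 * l / n)) := by gcongr
    have : 0 ≤ σ * (L * √(2 * l / n)) := by positivity
    linarith
  have h3 : 30 * (M * L / n) ≤ 200 / 3 * l * (M * L / n) :=
    mul_le_mul_of_nonneg_right (by linarith) (by positivity)
  calc _ = 9 * (√L * φ) + 3 * (σ * √(2 * L / n)) + 30 * (M * L / n) := by ring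
    _ ≤ 100 * (L * φ) + 100 * (σ * (L * √(2 * l / n))) + 200 / 3 * l * (M * L / n) := by
        linarith
    _ = _ := by
        field_simp
        ring

theorem oracle_bound_le_of_single_sample {φ σ M L : ℝ} (hφ : 0 ≤ φ) (hM : 0 ≤ M)
    (hσM : σ ≤ M) (hL : 169 / 100 ≤ L) :
    3 * (3 * √L * φ + σ * √(2 * L) + 10 * M * L) ≤ 100 * L * (φ + M) := by
  have hL0 : 0 < L := by linarith
  have hsqrt : √L ≤ L := by
    rw [Real.sqrt_le_left hL0.le]; nlinarith
  have hsqrt2 : √(2 * L) ≤ 2 * L := by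
    rw [Real.sqrt_le_left (by linarith)]; nlinarith
  have h1 : √L * φ ≤ L * φ := by gcongr
  have h2 : σ * √(2 * L) ≤ M * (2 * L) := by gcongr
  have h3 : 0 ≤ L * φ := by positivity
  have h4 : 0 ≤ M * L := by positivity
  linarith

/-! ### Union bound over the windows -/

section Event

variable {Ω : Type*} [MeasurableSpace Ω] {P : Measure Ω} [IsProbabilityMeasure P]
  {a b : ℝ} {t : ℕ} {B : ℕ → ℕ} {Q : ℕ → Measure ℝ} {u : ℕ → ℕ → Ω → ℝ}

/-- With probability at least `1 - δ`, every selected window satisfies the oracle bound against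
each `k ∈ [t]`. -/
theorem one_sub_le_measure_oracle (ht : 1 ≤ t) (hB : ∀ j ∈ Finset.Icc 1 t, 1 ≤ B j)
    (hQ : ∀ j ∈ Finset.Icc 1 t, ∀ᵐ x ∂(Q j), x ∈ Set.Icc a b)
    (hu : ∀ j ∈ Finset.Icc 1 t, ∀ i ∈ Finset.Icc 1 (B j), HasLaw (u j i) (Q j) P)
    (hind : iIndepFun (fun (p : sampleIndex B t) => u p.1.1 p.1.2) P) (hM : 0 ≤ b - a)
    {δ : ℝ} (hδ : δ ∈ Set.Ioo (0 : ℝ) 1) :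
    1 - δ ≤ P.real {ω | ∀ k' ∈ selectedWindows B (fun j i => u j i ω) (b - a) t (δ / (3 * t)),
      ∀ k ∈ Finset.Icc 1 t, |empMean B (fun j i => u j i ω) t k' - popMean Q t| ≤
        3 * (3 * √(Real.log (6 * t / δ)) * phi Q t k +
          popStd Q B t k * √(2 * Real.log (6 * t / δ) / windowSize B t k) +
          10 * (b - a) * Real.log (6 * t / δ) / windowSize B t k)} := by
  have ht' : (1 : ℝ) ≤ t := by exact_mod_cast ht
  have hδ0 := hδ.1
  have harg : 2 / (δ / (3 * t)) = 6 * t / δ := by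
    field_simp
    ring
  have hL := le_log_six_mul_div ht hδ
  have hL1 : 1 ≤ Real.log (2 / (δ / (3 * t))) := by rw [harg]; linarith
  have hbad := fun k hk => measure_not_window_good_le hB hQ hu hind hM hL1 (k := k) hk
  rw [harg] at hbad
  set L := Real.log (6 * t / δ) with hLdef
  have hexp : Real.exp (-L) = δ / (6 * t) := by
    rw [Real.exp_neg, hLdef, Real.exp_log (by positivity), inv_div]
  set bad : ℕ → Set Ω := fun k => {ω | ¬ (|empMean B (fun j i => u j i ω) t k - windowMean Q B t k| ≤
          psiHat B (fun j i => u j i ω) (b - a) t k (δ / (3 * t)) ∧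
        psiHat B (fun j i => u j i ω) (b - a) t k (δ / (3 * t)) ≤
          popStd Q B t k * √(2 * L / windowSize B t k) +
            √2 * √L * phi Q t k + 10 * (b - a) * L / windowSize B t k)} with hbaddef
  have hunion : P.real (⋃ k ∈ Finset.Icc 1 t, bad k) ≤ δ := by
    refine (measureReal_biUnion_finset_le _ _).trans ((Finset.sum_le_sum hbad).trans ?_)
    rw [hexp]
    simp only [Finset.sum_const, Nat.card_Icc, Nat.add_sub_cancel, nsmul_eq_mul]
    have : (t : ℝ) * (4 * (δ / (6 * t))) = 2 / 3 * δ := by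
      field_simp
      ring
    rw [this]
    linarith
  set G := {ω | ∀ k' ∈ selectedWindows B (fun j i => u j i ω) (b - a) t (δ / (3 * t)),
      ∀ k ∈ Finset.Icc 1 t, |empMean B (fun j i => u j i ω) t k' - popMean Q t| ≤
        3 * (3 * √L * phi Q t k + popStd Q B t k * √(2 * L / windowSize B t k) +
          10 * (b - a) * L / windowSize B t k)} with hG
  -- Covering the whole space and using subadditivity avoids any measurability question for `G`,
  -- which involves the data-driven selection.
  have hcover : (Set.univ : Set Ω) ⊆ G ∪ ⋃ k ∈ Finset.Icc 1 t, bad k := by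
    intro ω _
    by_cases hω : ω ∈ ⋃ k ∈ Finset.Icc 1 t, bad k
    · exact Or.inr hω
    · refine Or.inl fun k' hk' k hk => ?_
      have hgood : ∀ k ∈ Finset.Icc 1 t,
          |empMean B (fun j i => u j i ω) t k - windowMean Q B t k| ≤
          psiHat B (fun j i => u j i ω) (b - a) t k (δ / (3 * t)) ∧
        psiHat B (fun j i => u j i ω) (b - a) t k (δ / (3 * t)) ≤
          popStd Q B t k * √(2 * L / windowSize B t k) +
            √2 * √L * phi Q t k + 10 * (b - a) * L / windowSize B t k := by
        intro k hk
        by_contra h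
        exact hω (Set.mem_biUnion (t := bad) (by exact hk) h)
      have h1 := abs_empMean_selected_sub_le (Q := Q) hB (fun k hk => (hgood k hk).1) hk' hk
      have h2 := (hgood k hk).2
      have hφ := phi_nonneg (Q := Q) hk
      have hsL : 13 / 10 ≤ √L := by
        rw [Real.le_sqrt' (by norm_num)]; linarith
      have hs2 : √2 ≤ 3 / 2 := by
        rw [Real.sqrt_le_left (by norm_num)]; norm_num
      -- Absorbs the 5φ of the selection bound and three times the drift part of ψ̂ into 9√L φ.
      have hcoef : 5 + 3 * (√2 * √L) ≤ 9 * √L := by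
        have : √2 * √L ≤ 3 / 2 * √L := by gcongr
        linarith
      have h3 := mul_le_mul_of_nonneg_right hcoef hφ
      linarith
  have hone : (1 : ℝ) ≤ P.real G + P.real (⋃ k ∈ Finset.Icc 1 t, bad k) := by
    rw [← probReal_univ (μ := P)]
    exact (measureReal_mono hcover (measure_ne_top _ _)).trans (measureReal_union_le _ _)
  linarith

end Event

end RollingWindow

theorem mainTheorem1 :
    ∃ C : ℝ, 0 < C ∧
      ∀ {Ω : Type*} [MeasurableSpace Ω] (P : Measure Ω) [IsProbabilityMeasure P]
        (a b : ℝ) (t : ℕ) (_ : 1 ≤ t)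
        (B : ℕ → ℕ) (_ : ∀ j ∈ Finset.Icc 1 t, 1 ≤ B j)
        (Q : ℕ → Measure ℝ) (_ : ∀ j ∈ Finset.Icc 1 t, IsProbabilityMeasure (Q j))
        (_ : ∀ j ∈ Finset.Icc 1 t, ∀ᵐ x ∂(Q j), x ∈ Set.Icc a b)
        (u : ℕ → ℕ → Ω → ℝ)
        (_ : ∀ j ∈ Finset.Icc 1 t, ∀ i ∈ Finset.Icc 1 (B j), HasLaw (u j i) (Q j) P)
        (_ : iIndepFun (fun (p : RollingWindow.sampleIndex B t) => u p.1.1 p.1.2) P)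
        (δ : ℝ) (_ : δ ∈ Set.Ioo (0 : ℝ) 1),
        (1 - δ ≤ P.real {ω | ∀ k' ∈ RollingWindow.selectedWindows B (fun j i => u j i ω) (b - a) t
              (δ / (3 * t)),
            |RollingWindow.empMean B (fun j i => u j i ω) t k' - RollingWindow.popMean Q t| ≤
              C * Real.log (6 * t / δ) *
                ⨅ k : Finset.Icc 1 t,
                  (RollingWindow.phi Q t k + RollingWindow.psi Q B (b - a) t k δ)}) ∧
        (1 - δ ≤ P.real {ω | ∀ k' ∈ RollingWindow.selectedWindows B (fun j i => u j i ω) (b - a) t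
              (δ / (3 * t)),
            |RollingWindow.empMean B (fun j i => u j i ω) t k' - RollingWindow.popMean Q t| ≤
              3 * ⨅ k : Finset.Icc 1 t,
                (3 * √(Real.log (6 * t / δ)) * RollingWindow.phi Q t k
                  + RollingWindow.popStd Q B t k *
                      √(2 * Real.log (6 * t / δ) / RollingWindow.windowSize B t k)
                  + 10 * (b - a) * Real.log (6 * t / δ) / RollingWindow.windowSize B t k)}) := by
  refine ⟨100, by norm_num, ?_⟩
  intro Ω _ P _ a b t ht B hB Q hp hQ u hu hind δ hδ
  have hM : 0 ≤ b - a := by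
    have htt : t ∈ Finset.Icc 1 t := Finset.mem_Icc.mpr ⟨ht, le_rfl⟩
    have := hp t htt
    obtain ⟨x, hx⟩ := (hQ t htt).exists
    linarith [hx.1, hx.2]
  have hne : Nonempty (Finset.Icc 1 t) := ⟨⟨1, Finset.mem_Icc.mpr ⟨le_rfl, ht⟩⟩⟩
  have hmain := RollingWindow.one_sub_le_measure_oracle ht hB hQ hu hind hM hδ
  have hL := RollingWindow.le_log_six_mul_div ht hδ
  constructor
  · refine hmain.trans (measureReal_mono (fun ω hω k' hk' => ?_) (measure_ne_top _ _))
    -- The minimum is attained, so it suffices to compare the two bounds at a single `k`.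
    obtain ⟨⟨k, hk⟩, hkmin⟩ := exists_eq_ciInf_of_finite (f := fun k : Finset.Icc 1 t =>
      RollingWindow.phi Q t k + RollingWindow.psi Q B (b - a) t k δ)
    rw [← hkmin]
    refine (hω k' hk' k hk).trans ?_
    have hφ := RollingWindow.phi_nonneg (Q := Q) hk
    rw [RollingWindow.psi]
    split_ifs with hn
    · rw [hn, Nat.cast_one, div_one, div_one]
      exact RollingWindow.oracle_bound_le_of_single_sample hφ hM
        (RollingWindow.popStd_le hM hB hp hQ hk) hL
    · refine RollingWindow.oracle_bound_le hφ (Real.sqrt_nonneg _) hM ?_ hL ?_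
      · exact_mod_cast RollingWindow.windowSize_pos hB hk
      · have h2 := Real.log_two_gt_d9
        have h3 : Real.log 2 ≤ Real.log (2 / δ) := by
          refine Real.log_le_log two_pos ?_
          rw [le_div_iff₀ hδ.1]
          linarith [hδ.2]
        linarith
  · refine hmain.trans (measureReal_mono (fun ω hω k' hk' => ?_) (measure_ne_top _ _))
    obtain ⟨⟨k, hk⟩, hkmin⟩ := exists_eq_ciInf_of_finite (f := fun k : Finset.Icc 1 t =>
      3 * √(Real.log (6 * t / δ)) * RollingWindow.phi Q t k
        + RollingWindow.popStd Q B t k *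
            √(2 * Real.log (6 * t / δ) / RollingWindow.windowSize B t k)
        + 10 * (b - a) * Real.log (6 * t / δ) / RollingWindow.windowSize B t k)
    rw [← hkmin]
    exact hω k' hk' k hk
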